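/- Let $n\ge 2$ and let $\Gamma$ be the cyclic quiver with vertex set $\mathbf Z/n\mathbf Z$ and arrows $j\to j-1$. A multisegment is a finite formal sum $\mathbf m=\sum_{\ell\ge1,\,j\in\mathbf Z/n\mathbf Z} m_{(\ell;j]}\,(\ell;j]$ with $m_{(\ell;j]}\in\mathbf N$. For a field $\mathbf k$, let $\mathbf k[\ell;j]$ be the indecomposable nilpotent representation of $\Gamma$ of length $\ell$ with head at the vertex $j$, and put $\mathbf k[\mathbf m]=\bigoplus_{\ell,j}\mathbf k[\ell;j]^{\oplus m_{(\ell;j]}}$; these represent the isomorphism classes of nilpotent representations. Write $\dim\mathbf m\in\mathbf N^{\mathbf Z/n\mathbf Z}$ for the graded dimension and $|\dim\mathbf m|$ for the total dimension of $\mathbf k[\mathbf m]$, $\varepsilon(\mathbf m)=\dim\operatorname{End}\mathbf k[\mathbf m]$, and $\dim O_{\mathbf m}$ for the dimension of the orbit of $\mathbf k[\mathbf m]$ under change of basis at the vertices. Let $F^{\mathbf q}_{\mathbf o,\mathbf p}$ be the Hall polynomial: its value at each prime power $q$ is the number of subrepresentations of $\mathbf F_q[\mathbf q]$ isomorphic to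 $\mathbf F_q[\mathbf p]$ with quotient isomorphic to $\mathbf F_q[\mathbf o]$. The twisted Hall algebra $\mathcal H$ is the $\mathbf C(v)$-vector space with basis $\{u_{\mathbf m}\}$ and multiplication $$u_{\mathbf o}\circ u_{\mathbf p}=v^{\,\sum_j a_jb_{j-1}+\sum_j a_jb_j}\sum_{\mathbf q}F^{\mathbf q}_{\mathbf o,\mathbf p}(v^{-2})\,u_{\mathbf q},\qquad a=\dim\mathbf o,\quad b=\dim\mathbf p .$$ Its PBW basis consists of the vectors $\langle\mathbf m\rangle=v^{\dim O_{\mathbf m}}u_{\mathbf m}$. For $i\in\mathbf Z/n\mathbf Z$ the Chevalley generator $f_i$ acts on $\mathcal H$ by left multiplication by $\langle(1;i]\rangle$. Let $(\cdot,\cdot)$ be the bilinear form on $\mathcal H$ given by $$(\langle\mathbf m\rangle,\langle\mathbf m'\rangle)=\delta_{\mathbf m,\mathbf m'}\;v^{-2\varepsilon(\mathbf m)}\,\frac{(1-v^2)^{|\dim\mathbf m|}}{|\operatorname{Aut}\mathbf F_q[\mathbf m]|_{q=v^{-2}}},$$ where $|\operatorname{Aut}\mathbf F_q[\mathbf m]|$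 is regarded as a polynomial in $q$. For a multisegment $\mathbf m$ with $m_{(\ell;i]}\ne0$ put $\mathbf m^-_{\ell,i}=\mathbf m-(1;i]$ if $\ell=1$ and $\mathbf m^-_{\ell,i}=\mathbf m-(\ell;i]+(\ell-1;i-1]$ if $\ell>1$; if $m_{(\ell;i]}=0$ put $\langle\mathbf m^-_{\ell,i}\rangle=0$. **Proposition.** For every $i\in\mathbf Z/n\mathbf Z$ the operator $f_i$ has a unique adjoint $e'_i\in\operatorname{End}_{\mathbf C(v)}\mathcal H$ with respect to $(\cdot,\cdot)$, that is, $(e'_ix,y)=(x,f_iy)$ for all $x,y\in\mathcal H$, and for every multisegment $\mathbf m$ $$e'_i\langle\mathbf m\rangle=v^{\sum_{k>1}(m_{(k-1;i-1]}-m_{(k;i]})}\,v^{-m_{(1;i]}+1}\,\langle\mathbf m^-_{1,i}\rangle+\sum_{\ell\ge2}v^{\sum_{k>\ell}(m_{(k-1;i-1]}-m_{(k;i]})}\,v^{-m_{(\ell;i]}+1}\,\bigl(1-v^{2(m_{(\ell-1;i-1]}+1)}\bigr)\,\langle\mathbf m^-_{\ell,i}\rangle .$$ -/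

import Mathlib

open Polynomial

/-- A multisegment over `ZMod n`: the coefficient `m (ℓ, i)` is the multiplicity of the cyclic
segment `(ℓ; i]` of length `ℓ` which ends at `i`, that is `[i - ℓ + 1, …, i - 1, i]`. -/
abbrev Multisegment (n : ℕ) : Type := (ℕ+ × ZMod n) →₀ ℕ

/-- A representation of the cyclic quiver with vertex set `ZMod n` and one arrow `i → i - 1` for
every vertex `i`. -/
structure CyclicRep (K : Type) [Field K] (n : ℕ) where
  /-- the space at the vertex `i` -/
  V : ZMod n → Type
  [addCommGroup : ∀ i, AddCommGroup (V i)]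
  [module : ∀ i, Module K (V i)]
  /-- the map of the arrow `i → i - 1` -/
  x : ∀ i, V i →ₗ[K] V (i - 1)

attribute [instance] CyclicRep.addCommGroup CyclicRep.module

namespace CyclicRep

variable {K : Type} [Field K] {n : ℕ}

/-- Isomorphisms of representations: vertexwise linear equivalences that commute with the arrows. -/
abbrev Iso (M N : CyclicRep K n) : Type :=
  {e : ∀ i, M.V i ≃ₗ[K] N.V i //
    ∀ i, (N.x i) ∘ₗ (e i).toLinearMap = (e (i - 1)).toLinearMap ∘ₗ (M.x i)}

/-- A subrepresentation: subspaces at all vertices that the arrows respect. -/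
structure Subrep (M : CyclicRep K n) where
  /-- the subspace at the vertex `i` -/
  U : ∀ i, Submodule K (M.V i)
  map_mem : ∀ i, ∀ w ∈ U i, M.x i w ∈ U (i - 1)

/-- A subrepresentation, regarded as a representation. -/
def Subrep.toRep {M : CyclicRep K n} (S : Subrep M) : CyclicRep K n where
  V i := S.U i
  x i := (M.x i).restrict (S.map_mem i)

/-- The quotient by a subrepresentation. -/
def Subrep.quotient {M : CyclicRep K n} (S : Subrep M) : CyclicRep K n where
  V i := M.V i ⧸ S.U i
  x i := (S.U i).mapQ (S.U (i - 1)) (M.x i) (S.map_mem i)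

/-- The infinitesimal action, at the point `x`, of the group `∏ i, GL (V i)` which acts by
conjugation on `∏ i, Hom (V i, V (i - 1))`: the differential at `1` of the orbit map
`g ↦ (g (i - 1) ∘ x i ∘ (g i)⁻¹)_i`. -/
def infinitesimalAction (M : CyclicRep K n) :
    (∀ i, M.V i →ₗ[K] M.V i) →ₗ[K] (∀ i, M.V i →ₗ[K] M.V (i - 1)) where
  toFun a i := a (i - 1) ∘ₗ M.x i - M.x i ∘ₗ a i
  map_add' a b := by
    funext i
    simp only [Pi.add_apply, LinearMap.add_comp, LinearMap.comp_add]
    abel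
  map_smul' c a := by
    funext i
    simp only [Pi.smul_apply, LinearMap.smul_comp, LinearMap.comp_smul, smul_sub, RingHom.id_apply]

/-- The dimension of the orbit of `x` under `∏ i, GL (V i)`. The orbit is a smooth homogeneous
variety, and its dimension is that of its tangent space at `x`, which is the image of the
infinitesimal action. -/
noncomputable def orbitDim (M : CyclicRep K n) : ℕ :=
  Module.finrank K (LinearMap.range M.infinitesimalAction)

/-- The space of endomorphisms of a representation. -/
def endomorphisms (M : CyclicRep K n) : Submodule K (∀ i, M.V i →ₗ[K] M.V i) where
  carrier := {a | ∀ i, M.x i ∘ₗ a i = a (i - 1) ∘ₗ M.x i}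
  add_mem' {a b} ha hb i := by
    simp only [Set.mem_ofPred_eq] at ha hb
    simp only [Pi.add_apply, LinearMap.add_comp, LinearMap.comp_add, ha i, hb i]
  zero_mem' i := by simp
  smul_mem' c a ha i := by
    simp only [Set.mem_ofPred_eq] at ha
    simp only [Pi.smul_apply, LinearMap.smul_comp, LinearMap.comp_smul, ha i]

/-- `dim End M`. -/
noncomputable def endDim (M : CyclicRep K n) : ℕ := Module.finrank K M.endomorphisms

end CyclicRep

namespace Multisegment

variable {n : ℕ}

/-- The cells of the diagram of `m`: a segment `(ℓ; j]`, one of its `m (ℓ, j)` copies, and a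
position `p < ℓ`, counted from the end `j`. -/
abbrev Cell (m : Multisegment n) : Type := Σ s : ℕ+ × ZMod n, Fin (m s) × Fin (s.1 : ℕ)

/-- The vertex which a cell contains: `j - p` for the position `p` in `(ℓ; j]`. -/
def Cell.vertex {m : Multisegment n} (c : m.Cell) : ZMod n := c.1.2 - ((c.2.2 : ℕ) : ZMod n)

/-- The next cell `p + 1` of the same copy of the same segment. -/
def Cell.next {m : Multisegment n} (c : m.Cell) (h : (c.2.2 : ℕ) + 1 < c.1.1) : m.Cell :=
  ⟨c.1, c.2.1, ⟨(c.2.2 : ℕ) + 1, h⟩⟩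

theorem Cell.vertex_next {m : Multisegment n} (c : m.Cell) (h : (c.2.2 : ℕ) + 1 < c.1.1) :
    (c.next h).vertex = c.vertex - 1 := by
  simp only [Cell.vertex, Cell.next]
  push_cast
  ring

/-- The nilpotent representation `K[m] = ⨁ K[ℓ; j]^{m (ℓ, j)}`. The indecomposable `K[ℓ; j]` of
length `ℓ` and head `K[j]` has a basis of vectors at the vertices `j, j - 1, …, j - ℓ + 1`, each of
which is sent to the next one and the last one to `0`. -/
noncomputable def rep (K : Type) [Field K] (m : Multisegment n) : CyclicRep K n where
  V i := {c : m.Cell // c.vertex = i} →₀ K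
  x i := Finsupp.linearCombination K fun c : {c : m.Cell // c.vertex = i} =>
    if h : (c.1.2.2 : ℕ) + 1 < c.1.1.1 then
      Finsupp.single (⟨c.1.next h, by rw [Cell.vertex_next, c.2]⟩ :
        {c : m.Cell // c.vertex = i - 1}) (1 : K)
    else 0

/-- The graded dimension of the representation labelled by `m` (it is the same over all fields). -/
noncomputable def dimVec (m : Multisegment n) (i : ZMod n) : ℕ :=
  Module.finrank ℂ ((m.rep ℂ).V i)

/-- The total dimension of the representation labelled by `m`. -/
noncomputable def totalDim [NeZero n] (m : Multisegment n) : ℕ := ∑ i : ZMod n, m.dimVec i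

/-- The dimension of the orbit `O_m`. -/
noncomputable def orbitDim (m : Multisegment n) : ℕ := (m.rep ℂ).orbitDim

/-- `ε(m)`, the dimension of the endomorphism space of the representation labelled by `m`. -/
noncomputable def endDim (m : Multisegment n) : ℕ := (m.rep ℂ).endDim

end Multisegment

/-- `F` is the polynomial that interpolates a function `c` of finite fields: `F(q) = c(𝔽_q)`. -/
def IsCountingPolynomial (c : ∀ (K : Type) [Field K] [Finite K], ℕ) (F : ℤ[X]) : Prop :=
  ∀ (K : Type) [Field K] [Finite K], F.eval (Nat.card K : ℤ) = c K

open Classical in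
/-- The unique polynomial with integer coefficients that interpolates `c`, if there is one. -/
noncomputable def countingPolynomial (c : ∀ (K : Type) [Field K] [Finite K], ℕ) : ℤ[X] :=
  if h : ∃ F, IsCountingPolynomial c F then h.choose else 0

namespace Multisegment

variable {n : ℕ}

/-- The number of subrepresentations of `K[q]` of type `p` and cotype `o`. -/
noncomputable def hallNumber (o p q : Multisegment n) (K : Type) [Field K] : ℕ :=
  Nat.card {S : CyclicRep.Subrep (q.rep K) //
    Nonempty (CyclicRep.Iso S.toRep (p.rep K)) ∧ Nonempty (CyclicRep.Iso S.quotient (o.rep K))}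

/-- The Hall polynomial `F^q_{o,p}`. -/
noncomputable def hallPolynomial (o p q : Multisegment n) : ℤ[X] :=
  countingPolynomial fun K _ _ => hallNumber o p q K

/-- The polynomial in `q` that gives the number of automorphisms of `𝔽_q[m]`. -/
noncomputable def autPolynomial (m : Multisegment n) : ℤ[X] :=
  countingPolynomial fun K _ _ => Nat.card (CyclicRep.Iso (m.rep K) (m.rep K))

/-- The bilinear form `∑_{i → j} a_i b_j + ∑_i a_i b_i`, the first sum over the arrows
`i → i - 1`. -/
def twistForm [NeZero n] (a b : ZMod n → ℕ) : ℕ :=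
  ∑ i : ZMod n, a i * b (i - 1) + ∑ i : ZMod n, a i * b i

end Multisegment

namespace CyclicHall

/-- The field `ℂ(v)`. -/
abbrev Cv : Type := RatFunc ℂ

/-- The indeterminate `v`. -/
noncomputable def v : Cv := RatFunc.X

theorem v_ne_zero : v ≠ 0 := RatFunc.X_ne_zero

/-- The space of the generic twisted Hall algebra: the `ℂ(v)`-vector space with one basis vector
for each isomorphism class of nilpotent representations, that is for each multisegment. -/
abbrev HallSpace (n : ℕ) : Type := Multisegment n →₀ Cv

variable (n : ℕ)

/-- The basis `u_m`. -/
noncomputable def u : Module.Basis (Multisegment n) Cv (HallSpace n) := Finsupp.basisSingleOne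

/-- The PBW basis `⟨m⟩ = v ^ (dim O_m) u_m`. -/
noncomputable def pbw : Module.Basis (Multisegment n) Cv (HallSpace n) :=
  (u n).unitsSMul fun m => (Units.mk0 v v_ne_zero) ^ m.orbitDim

/-- The multiplication of the twisted Hall algebra, as a bilinear map:
`u_o ∘ u_p = v ^ m(dim o, dim p) ∑_q F^q_{o,p}(v⁻²) u_q`. (The sum is finite, since `F^q_{o,p} = 0`
unless `dim q = dim o + dim p`.) -/
noncomputable def hallMul [NeZero n] : HallSpace n →ₗ[Cv] HallSpace n →ₗ[Cv] HallSpace n :=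
  (u n).constr Cv fun o => (u n).constr Cv fun p =>
    v ^ Multisegment.twistForm o.dimVec p.dimVec •
      ∑ᶠ q : Multisegment n, (aeval (v ^ (-2 : ℤ)) (o.hallPolynomial p q)) • u n q

variable {n}

/-- The action of the Chevalley generator `f_i`: left multiplication by `⟨O_i⟩`, where `O_i` is
the orbit of the simple representation at `i`, labelled by the multisegment `(1; i]`. -/
noncomputable def chevalleyF [NeZero n] (i : ZMod n) : Module.End Cv (HallSpace n) :=
  hallMul n (pbw n (Finsupp.single (1, i) 1))

variable (n)

/-- The normalized scalar product: the bilinear form for which the PBW basis is orthogonal, with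
`(⟨m⟩, ⟨m⟩) = v ^ (-2 ε(m)) (1 - v²) ^ (dim m) / |Aut 𝔽_q[m]|` at `q = v⁻²`. -/
noncomputable def scalarProduct [NeZero n] : LinearMap.BilinForm Cv (HallSpace n) :=
  (pbw n).constr Cv fun m =>
    (v ^ (-2 * (m.endDim : ℤ)) * ((1 - v ^ 2) ^ m.totalDim /
      aeval (v ^ (-2 : ℤ)) m.autPolynomial)) • (pbw n).coord m

variable {n}

/-- The multisegment `m⁻_{ℓ,i}`, for `m (ℓ, i) ≠ 0`. -/
noncomputable def minus (m : Multisegment n) (ℓ : ℕ+) (i : ZMod n) : Multisegment n :=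
  if ℓ = 1 then m - Finsupp.single (1, i) 1
  else m - Finsupp.single (ℓ, i) 1 + Finsupp.single (ℓ - 1, i - 1) 1

/-- The vector `⟨m⁻_{ℓ,i}⟩`, which is `0` by convention if `m (ℓ, i) = 0`. -/
noncomputable def pbwMinus (m : Multisegment n) (ℓ : ℕ+) (i : ZMod n) : HallSpace n :=
  if m (ℓ, i) = 0 then 0 else pbw n (minus m ℓ i)

/-- The exponent `∑_{k > ℓ} (m_{(k-1; i-1]} - m_{(k; i]})`, which has finitely many nonzero
terms. -/
noncomputable def expo (m : Multisegment n) (ℓ : ℕ+) (i : ZMod n) : ℤ :=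
  ∑ᶠ (k : ℕ+) (_ : ℓ < k), ((m (k - 1, i - 1) : ℤ) - (m (k, i) : ℤ))

end CyclicHall

/-!
The PBW basis is orthogonal for the scalar product, and its vectors are not isotropic. So the
adjoint of `f_i` is determined, coefficient by coefficient, by
`(e'_i ⟨m⟩, ⟨p⟩) = (⟨m⟩, f_i ⟨p⟩)`, and it exists because only finitely many `⟨p⟩` pair nontrivially
with a given `⟨m⟩`. The formula for `e'_i ⟨m⟩` is then a computation of three quantities.

* The number of automorphisms of `K[m]`. An endomorphism is given by the images of the generators of
  the segments, and its coefficients can be chosen freely on a set of pairs of cells that does not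
  depend on the field (`endEquiv`). With respect to the cells, ordered by `blockKey`, it is block
  triangular, and the diagonal blocks are arbitrary square matrices of the sizes `m_s`. Hence
  `|Aut K[m]| = q ^ (ε(m) - ∑ m_s²) ∏ |GL_{m_s}(K)|` (`autPoly_isCountingPolynomial`), and the powers
  of `v` cancel in the norm of `⟨m⟩`, which is `(1 - v²)^|dim m| / ∏_s ∏_{k ≤ m_s} (1 - v^{2k})`.
* The Hall polynomial `F^m_{(1;i],p}`. A subrepresentation of `K[m]` with quotient `K[1; i]` is the
  kernel of a nonzero functional `ψ` on the head at `i`, which is unique up to scalars. If `ℓ` is the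
  least length of a segment on whose head `ψ` does not vanish, then an automorphism of `K[m]` carries
  `ψ` to a coordinate function of a segment `(ℓ; i]`, whence the kernel is of type `m⁻_{ℓ,i}`
  (`headSub_iso`). These types are pairwise different, and counting functionals gives
  `(q - 1) F = q ^ (∑_{k > ℓ} m_{(k;i]}) (q ^ m_{(ℓ;i]} - 1)` for `p = m⁻_{ℓ,i}`
  (`hallPolynomial_minus`), while `F = 0` for the other `p` (`hallPolynomial_eq_zero`).
* The change of `dim O_m`. It is `∑_i (dim m)_i² - ε(m)`, and `ε` is a sum over pairs of segments, in
  which replacing `(ℓ; i]` by `(ℓ - 1; i - 1]` is controlled by telescoping sums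
  (`segHom_succ_right`, `segHom_succ_left`, `endDim_minus`).

These are put together in `normSq_mul_coord`.
-/

/-! ### The cells as bases of the representations -/

namespace Multisegment

variable {n : ℕ} {m : Multisegment n}

/-- The length of the segment that a cell belongs to. -/
abbrev Cell.len (c : m.Cell) : ℕ := c.1.1

/-- The position of a cell in its segment, counted from the head. -/
abbrev Cell.pos (c : m.Cell) : ℕ := c.2.2

/-- The cell at position `p` of the same copy of the same segment. -/
def Cell.move (c : m.Cell) (p : ℕ) (h : p < c.len) : m.Cell := ⟨c.1, c.2.1, ⟨p, h⟩⟩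

/-- The cell at position `0` of the same copy of the same segment. -/
def Cell.head (c : m.Cell) : m.Cell := c.move 0 c.1.1.pos

theorem Cell.pos_lt (c : m.Cell) : c.pos < c.len := c.2.2.2

theorem Cell.vertex_eq (c : m.Cell) : c.vertex = c.1.2 - (c.pos : ZMod n) := rfl

theorem Cell.vertex_head (c : m.Cell) : c.head.vertex = c.1.2 := by
  simp [Cell.vertex, Cell.head, Cell.move]

theorem Cell.move_vertex {c d : m.Cell} (h : c.vertex = d.vertex) (hcd : c.pos ≤ d.pos) (hp) :
    (d.move (d.pos - c.pos) hp).vertex = c.1.2 := by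
  simp only [Cell.vertex, Cell.move] at h ⊢
  rw [Nat.cast_sub hcd, sub_sub_eq_add_sub, sub_eq_iff_eq_add.mp h]
  ring

theorem Cell.head_eq_self {c : m.Cell} (h : c.pos = 0) : c.head = c := by
  obtain ⟨s, a, p, hp⟩ := c
  change p = 0 at h
  subst h
  rfl

theorem Cell.ext_of_vertex {c d : m.Cell} (hl : c.len = d.len) (hp : c.pos = d.pos)
    (hv : c.vertex = d.vertex) : c.1 = d.1 := by
  refine Prod.ext (PNat.eq hl) ?_
  have := Cell.vertex_eq c
  rw [hv, Cell.vertex_eq, hp] at this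
  exact (sub_left_injective this).symm

theorem Cell.vertex_pred {d : m.Cell} {i : ZMod n} (hd : d.vertex = i - 1) (h : 0 < d.pos) (hp) :
    (d.move (d.pos - 1) hp).vertex = i := by
  simp only [Cell.vertex, Cell.move] at hd ⊢
  rw [Nat.cast_sub h, ← sub_add_cancel i 1, ← hd]
  push_cast
  ring

variable (m) in
/-- Cells, grouped by the finitely many labels that occur. -/
def cellEquiv : m.Cell ≃ Σ s : m.support, Fin (m s) × Fin ((s : ℕ+ × ZMod n).1 : ℕ) where
  toFun c := ⟨⟨c.1, Finsupp.mem_support_iff.mpr fun h => by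
    have := c.2.1.2
    omega⟩, c.2⟩
  invFun c := ⟨c.1, c.2⟩
  left_inv _ := rfl
  right_inv _ := rfl

instance : Finite m.Cell := Finite.of_equiv _ m.cellEquiv.symm

noncomputable instance : Fintype m.Cell := Fintype.ofFinite _

noncomputable instance (i : ZMod n) : Fintype {c : m.Cell // c.vertex = i} := Fintype.ofFinite _

theorem sum_cell {A : Type*} [AddCommMonoid A] (F : m.Cell → A) :
    ∑ c, F c = m.sum fun s _ => ∑ b : Fin (m s), ∑ p : Fin (s.1 : ℕ), F ⟨s, b, p⟩ := by
  rw [← Equiv.sum_comp m.cellEquiv.symm F, Fintype.sum_sigma, Finsupp.sum,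
    ← Finset.sum_coe_sort m.support]
  refine Fintype.sum_congr _ _ fun s => ?_
  rw [Fintype.sum_prod_type]
  rfl

/-- If `F` depends only on the label and the position, then all copies contribute the same. -/
theorem sum_cell_of_pos (F : ℕ+ × ZMod n → ℕ → ℤ) :
    ∑ c : m.Cell, F c.1 c.pos = m.sum fun s a => (a : ℤ) * ∑ p ∈ Finset.range s.1, F s p := by
  rw [sum_cell]
  refine Finsupp.sum_congr fun s _ => ?_
  change ∑ _ : Fin (m s), ∑ p : Fin (s.1 : ℕ), F s p = _
  rw [Finset.sum_const, Finset.card_univ, Fintype.card_fin, nsmul_eq_mul,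
    Fin.sum_univ_eq_sum_range (fun p => F s p)]

theorem sum_head (F : ℕ+ × ZMod n → ℤ) :
    ∑ c : m.Cell, (if c.pos = 0 then F c.1 else 0) = m.sum fun s a => (a : ℤ) * F s := by
  rw [sum_cell_of_pos fun s p => if p = 0 then F s else 0]
  refine Finsupp.sum_congr fun s _ => ?_
  rw [Finset.sum_ite_eq' (Finset.range s.1) 0 fun _ => F s, if_pos (by simp)]

/-- The basis of `K[m]` at the vertex `i` that is given by the cells. -/
noncomputable def cellBasis (K : Type) [Field K] (m : Multisegment n) (i : ZMod n) :
    Module.Basis {c : m.Cell // c.vertex = i} K ((m.rep K).V i) :=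
  (Finsupp.basisSingleOne : Module.Basis _ K ({c : m.Cell // c.vertex = i} →₀ K))

variable {K : Type} [Field K]

instance (i : ZMod n) : Module.Finite K ((m.rep K).V i) := Module.Finite.of_basis (cellBasis K m i)

theorem next_vertex {i : ZMod n} (c : {c : m.Cell // c.vertex = i})
    (h : c.1.pos + 1 < c.1.len) : (c.1.move (c.1.pos + 1) h).vertex = i - 1 := by
  have := Cell.vertex_next c.1 h
  rw [c.2] at this
  exact this

/-- A cell whose position is not `0` is the next cell of another one. -/
theorem exists_next_eq {j : ZMod n} (c : {c : m.Cell // c.vertex = j - 1}) (h0 : 0 < c.1.pos) :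
    ∃ (c' : {c : m.Cell // c.vertex = j}) (h : c'.1.pos + 1 < c'.1.len),
      c'.1.pos + 1 = c.1.pos ∧ c = ⟨c'.1.move (c'.1.pos + 1) h, next_vertex c' h⟩ := by
  have hl := c.1.pos_lt
  refine ⟨⟨c.1.move (c.1.pos - 1) (by omega), Cell.vertex_pred c.2 h0 _⟩, ?_, ?_, ?_⟩
  · change c.1.pos - 1 + 1 < c.1.len
    omega
  · exact Nat.sub_add_cancel h0
  · refine Subtype.ext ?_
    change c.1 = c.1.move (c.1.pos - 1 + 1) _
    simp only [Nat.sub_add_cancel h0]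
    rfl

theorem x_cellBasis {i : ZMod n} (c : {c : m.Cell // c.vertex = i}) :
    (m.rep K).x i (cellBasis K m i c) =
      if h : c.1.pos + 1 < c.1.len then
        cellBasis K m (i - 1) ⟨c.1.move (c.1.pos + 1) h, next_vertex c h⟩ else 0 := by
  refine (Finsupp.linearCombination_single (M := {c : m.Cell // c.vertex = i - 1} →₀ K) K
    (1 : K) c).trans ((one_smul K _).trans ?_)
  split_ifs <;> rfl

theorem repr_x {i : ZMod n} (w : (m.rep K).V i) (d : {c : m.Cell // c.vertex = i - 1}) :
    (cellBasis K m (i - 1)).repr ((m.rep K).x i w) d =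
      if h : 0 < d.1.pos then
        (cellBasis K m i).repr w ⟨d.1.move (d.1.pos - 1) (by have := d.1.pos_lt; omega),
          Cell.vertex_pred d.2 h _⟩
      else 0 := by
  classical
  have hw : w ∈ Submodule.span K (Set.range (cellBasis K m i)) := by
    rw [Module.Basis.span_eq]
    trivial
  induction hw using Submodule.span_induction with
  | zero => simp
  | add v w _ _ hv hw =>
    rw [map_add, map_add, Finsupp.add_apply, hv, hw]
    split_ifs <;> simp
  | smul a v _ hv =>
    rw [map_smul, map_smul, Finsupp.smul_apply, hv]
    split_ifs <;> simp
  | mem w hw =>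
    obtain ⟨⟨⟨s, a, p, hp⟩, hc⟩, rfl⟩ := hw
    obtain ⟨⟨t, b, q, hq⟩, hd⟩ := d
    rw [x_cellBasis]
    simp only [Cell.move, Cell.pos, Cell.len]
    by_cases h0 : 0 < q
    · rw [dif_pos h0, Module.Basis.repr_self, Finsupp.single_apply]
      by_cases h1 : p + 1 < s.1
      · rw [dif_pos h1, Module.Basis.repr_self, Finsupp.single_apply]
        refine if_congr ?_ rfl rfl
        simp only [Subtype.mk.injEq]
        constructor <;> intro h
        · obtain ⟨rfl, h⟩ := Sigma.mk.inj h
          simp only [heq_eq_eq, Prod.mk.injEq, Fin.mk.injEq] at h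
          obtain ⟨rfl, rfl⟩ := h
          rfl
        · obtain ⟨rfl, h⟩ := Sigma.mk.inj h
          simp only [heq_eq_eq, Prod.mk.injEq, Fin.mk.injEq] at h
          obtain ⟨rfl, rfl⟩ := h
          simp only [Sigma.mk.injEq, heq_eq_eq, Prod.mk.injEq, Fin.mk.injEq, true_and]
          omega
      · rw [dif_neg h1, map_zero, Finsupp.zero_apply, if_neg]
        rintro h
        simp only [Subtype.mk.injEq] at h
        obtain ⟨rfl, h⟩ := Sigma.mk.inj h
        simp only [heq_eq_eq, Prod.mk.injEq, Fin.mk.injEq] at h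
        omega
    · rw [dif_neg h0]
      split_ifs with h1
      · rw [Module.Basis.repr_self, Finsupp.single_apply, if_neg]
        rintro h
        simp only [Subtype.mk.injEq] at h
        obtain ⟨rfl, h⟩ := Sigma.mk.inj h
        simp only [heq_eq_eq, Prod.mk.injEq, Fin.mk.injEq] at h
        omega
      · simp

theorem finrank_rep (i : ZMod n) :
    Module.finrank K ((m.rep K).V i) = Fintype.card {c : m.Cell // c.vertex = i} :=
  Module.finrank_eq_card_basis (cellBasis K m i)

/-- The dimension at the vertex `j` of the indecomposable with label `s`. -/
def segDim (j : ZMod n) (s : ℕ × ZMod n) : ℤ :=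
  ∑ p ∈ Finset.range s.1, if s.2 - (p : ZMod n) = j then 1 else 0

theorem dimVec_eq (j : ZMod n) :
    (m.dimVec j : ℤ) = m.sum fun s a => (a : ℤ) * segDim j (s.1, s.2) := by
  rw [dimVec, finrank_rep, Fintype.card_subtype, Finset.card_filter]
  push_cast
  exact sum_cell_of_pos fun s p => if s.2 - (p : ZMod n) = j then 1 else 0

theorem orbitDim_add_endDim [NeZero n] :
    m.orbitDim + m.endDim = ∑ i, m.dimVec i ^ 2 := by
  have h := LinearMap.finrank_range_add_finrank_ker (m.rep ℂ).infinitesimalAction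
  have hk : LinearMap.ker (m.rep ℂ).infinitesimalAction = (m.rep ℂ).endomorphisms := by
    ext a
    rw [LinearMap.mem_ker, funext_iff]
    refine forall_congr' fun i => ?_
    exact sub_eq_zero.trans eq_comm
  rw [hk] at h
  refine h.trans ?_
  rw [Module.finrank_pi_fintype]
  refine Finset.sum_congr rfl fun i _ => ?_
  rw [Module.finrank_linearMap, sq]
  rfl

end Multisegment

/-! ### Endomorphisms -/

namespace Multisegment

variable {n : ℕ} {m : Multisegment n} {K : Type} [Field K]

theorem mem_endomorphisms_iff (f : ∀ i, (m.rep K).V i →ₗ[K] (m.rep K).V i) :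
    f ∈ (m.rep K).endomorphisms ↔
      ∀ i (c : {c : m.Cell // c.vertex = i}) (d : {c : m.Cell // c.vertex = i - 1}),
        (if h : 0 < d.1.pos then
          LinearMap.toMatrix (cellBasis K m i) (cellBasis K m i) (f i)
            ⟨d.1.move (d.1.pos - 1) (by have := d.1.pos_lt; omega), Cell.vertex_pred d.2 h _⟩ c
          else 0) =
        if h : c.1.pos + 1 < c.1.len then
          LinearMap.toMatrix (cellBasis K m (i - 1)) (cellBasis K m (i - 1)) (f (i - 1)) d
            ⟨c.1.move (c.1.pos + 1) h, next_vertex c h⟩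
          else 0 := by
  refine forall_congr' fun i => ?_
  have key : ∀ c d, ((if h : 0 < d.1.pos then
          LinearMap.toMatrix (cellBasis K m i) (cellBasis K m i) (f i)
            ⟨d.1.move (d.1.pos - 1) (by have := d.1.pos_lt; omega), Cell.vertex_pred d.2 h _⟩ c
          else 0) =
        if h : c.1.pos + 1 < c.1.len then
          LinearMap.toMatrix (cellBasis K m (i - 1)) (cellBasis K m (i - 1)) (f (i - 1)) d
            ⟨c.1.move (c.1.pos + 1) h, next_vertex c h⟩
          else 0) ↔
      (cellBasis K m (i - 1)).repr (((m.rep K).x i ∘ₗ f i) (cellBasis K m i c)) d =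
      (cellBasis K m (i - 1)).repr ((f (i - 1) ∘ₗ (m.rep K).x i) (cellBasis K m i c)) d := by
    intro c d
    rw [LinearMap.comp_apply, LinearMap.comp_apply, repr_x, x_cellBasis]
    simp only [LinearMap.toMatrix_apply]
    refine Eq.congr rfl ?_
    split_ifs <;> simp
  simp only [key]
  constructor
  · intro h c d
    have h : (m.rep K).x i ∘ₗ f i = f (i - 1) ∘ₗ (m.rep K).x i := h
    rw [h]
  · intro h
    exact (cellBasis K m i).ext fun c => (cellBasis K m (i - 1)).repr.injective
      (Finsupp.ext fun d => h c d)

variable (m) in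
/-- The index set of a basis of `End K[m]`: an endomorphism is given by the images of the
generators (the cells at position `0`), and the segment of length `ℓ` at `j` may be sent to any
combination of those cells at `j` which are killed by the `ℓ`-th power of `x`. -/
abbrev EndIndex : Type :=
  {gd : m.Cell × m.Cell // gd.1.pos = 0 ∧ gd.1.vertex = gd.2.vertex ∧
    gd.2.len ≤ gd.1.len + gd.2.pos}

noncomputable instance : Fintype m.EndIndex := Fintype.ofFinite _

/-- The matrix, at the vertex `i`, of the endomorphism with the coefficients `B`. -/
def endMatrix (B : m.EndIndex → K) (i : ZMod n) :
    Matrix {c : m.Cell // c.vertex = i} {c : m.Cell // c.vertex = i} K := fun d c =>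
  if h : c.1.pos ≤ d.1.pos ∧ d.1.len + c.1.pos ≤ c.1.len + d.1.pos then
    B ⟨(c.1.head, d.1.move (d.1.pos - c.1.pos) (by have := d.1.pos_lt; omega)), rfl, by
      rw [Cell.vertex_head, Cell.move_vertex (c.2.trans d.2.symm) h.1],
      show d.1.len ≤ c.1.len + (d.1.pos - c.1.pos) by omega⟩
  else 0

theorem endMatrix_mem (B : m.EndIndex → K) :
    (fun i => Matrix.toLin (cellBasis K m i) (cellBasis K m i) (endMatrix B i)) ∈
      (m.rep K).endomorphisms := by
  rw [mem_endomorphisms_iff]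
  intro i c d
  simp only [LinearMap.toMatrix_toLin, endMatrix]
  have hc := c.1.pos_lt
  have hd := d.1.pos_lt
  by_cases h : 0 < d.1.pos ∧ c.1.pos + 1 < c.1.len ∧ c.1.pos + 1 ≤ d.1.pos ∧
      d.1.len + (c.1.pos + 1) ≤ c.1.len + d.1.pos
  · obtain ⟨h1, h2, h3, h4⟩ := h
    rw [dif_pos h1, dif_pos h2, dif_pos, dif_pos]
    rotate_left
    · exact ⟨h3, h4⟩
    · constructor
      · change c.1.pos ≤ d.1.pos - 1
        omega
      · change d.1.len + c.1.pos ≤ c.1.len + (d.1.pos - 1)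
        omega
    · congr 1
      refine Subtype.ext (Prod.ext rfl ?_)
      simp only [Cell.move, Sigma.mk.injEq, heq_eq_eq, Prod.mk.injEq, Fin.mk.injEq, true_and]
      change d.1.pos - 1 - c.1.pos = d.1.pos - (c.1.pos + 1)
      omega
  · trans (0 : K)
    · split_ifs with h1 h2
      · exfalso
        have h2a : c.1.pos ≤ d.1.pos - 1 := h2.1
        have h2b : d.1.len + c.1.pos ≤ c.1.len + (d.1.pos - 1) := h2.2
        omega
      · rfl
      · rfl
    · split_ifs with h1 h2
      · exfalso
        have h2a : c.1.pos + 1 ≤ d.1.pos := h2.1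
        have h2b : d.1.len + (c.1.pos + 1) ≤ c.1.len + d.1.pos := h2.2
        omega
      · rfl
      · rfl

/-- A cell `d` has coefficient zero in the image of the cell `c` if more steps lead from `d` to the
end of its segment than from `c`. -/
theorem toMatrix_eq_zero {f : ∀ i, (m.rep K).V i →ₗ[K] (m.rep K).V i}
    (hf : f ∈ (m.rep K).endomorphisms) (i : ZMod n) (c d : {c : m.Cell // c.vertex = i})
    (h : c.1.len + d.1.pos < d.1.len + c.1.pos) :
    LinearMap.toMatrix (cellBasis K m i) (cellBasis K m i) (f i) d c = 0 := by
  rw [mem_endomorphisms_iff] at hf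
  have hc := c.1.pos_lt
  have hd : d.1.pos + 1 < d.1.len := by omega
  obtain ⟨k, hk⟩ : ∃ k, k = c.1.len - c.1.pos := ⟨_, rfl⟩
  induction k generalizing i with
  | zero => omega
  | succ k ih =>
    have e := hf i c ⟨d.1.move (d.1.pos + 1) hd, next_vertex d hd⟩
    rw [dif_pos (show 0 < (d.1.move (d.1.pos + 1) hd).pos from Nat.succ_pos _)] at e
    refine e.trans ?_
    split_ifs with h1
    · refine ih (i - 1) _ _ ?_ ?_ ?_ ?_
      · change c.1.len + (d.1.pos + 1) < d.1.len + (c.1.pos + 1)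
        omega
      · exact h1
      · change d.1.pos + 1 + 1 < d.1.len
        omega
      · change k = c.1.len - (c.1.pos + 1)
        omega
    · rfl

/-- An endomorphism that kills all the generators is zero. -/
theorem toMatrix_eq_zero_of_gen {f : ∀ i, (m.rep K).V i →ₗ[K] (m.rep K).V i}
    (hf : f ∈ (m.rep K).endomorphisms)
    (h0 : ∀ i (c d : {c : m.Cell // c.vertex = i}), c.1.pos = 0 →
      d.1.len ≤ c.1.len + d.1.pos →
      LinearMap.toMatrix (cellBasis K m i) (cellBasis K m i) (f i) d c = 0)
    (i : ZMod n) (c d : {c : m.Cell // c.vertex = i}) :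
    LinearMap.toMatrix (cellBasis K m i) (cellBasis K m i) (f i) d c = 0 := by
  obtain ⟨k, hk⟩ : ∃ k, k = c.1.pos := ⟨_, rfl⟩
  induction k generalizing i with
  | zero =>
    rcases le_or_gt d.1.len (c.1.len + d.1.pos) with h | h
    · exact h0 i c d hk.symm h
    · exact toMatrix_eq_zero hf i c d (by omega)
  | succ k ih =>
    obtain ⟨j, rfl⟩ : ∃ j, i = j - 1 := ⟨i + 1, by ring⟩
    obtain ⟨c', h1, hk', rfl⟩ := exists_next_eq c (by omega)
    have e := ((mem_endomorphisms_iff f).mp hf) j c' d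
    rw [dif_pos h1] at e
    refine e.symm.trans ?_
    split_ifs with h3
    · exact ih j _ _ (by omega)
    · rfl

variable (m K) in
/-- Endomorphisms of `K[m]` correspond to the coefficients of the images of the generators. -/
noncomputable def endEquiv : (m.EndIndex → K) ≃ₗ[K] (m.rep K).endomorphisms := by
  refine LinearEquiv.ofBijective
    { toFun := fun B => ⟨_, endMatrix_mem B⟩
      map_add' := fun B B' => ?_
      map_smul' := fun a B => ?_ } ⟨?_, ?_⟩
  · refine Subtype.ext (funext fun i => ?_)
    have h : endMatrix (B + B') i = endMatrix B i + endMatrix B' i := by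
      ext d c
      simp only [endMatrix, Matrix.add_apply]
      split_ifs <;> simp
    exact (congrArg (Matrix.toLin (cellBasis K m i) (cellBasis K m i)) h).trans (map_add _ _ _)
  · refine Subtype.ext (funext fun i => ?_)
    have h : endMatrix (a • B) i = a • endMatrix B i := by
      ext d c
      simp only [endMatrix, Matrix.smul_apply]
      split_ifs <;> simp
    exact (congrArg (Matrix.toLin (cellBasis K m i) (cellBasis K m i)) h).trans (map_smul _ _ _)
  · intro B B' h
    funext gd
    obtain ⟨⟨g, d⟩, h1, h2, h3⟩ := gd
    have e := congrFun (Subtype.ext_iff.mp h) d.vertex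
    have e := congrFun (congrFun ((Matrix.toLin _ _).injective e) ⟨d, rfl⟩) ⟨g, h2⟩
    simp only [endMatrix] at e h1 h2 h3
    have h4 : g.pos ≤ d.pos ∧ d.len + g.pos ≤ g.len + d.pos := by omega
    rw [dif_pos h4, dif_pos h4] at e
    simp only [Cell.head_eq_self h1, h1] at e
    exact e
  · intro f
    refine ⟨fun gd => LinearMap.toMatrix (cellBasis K m gd.1.2.vertex)
      (cellBasis K m gd.1.2.vertex) (f.1 gd.1.2.vertex) ⟨gd.1.2, rfl⟩ ⟨gd.1.1, gd.2.2.1⟩, ?_⟩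
    rw [← sub_eq_zero]
    refine Subtype.ext (funext fun i => ?_)
    refine (LinearMap.toMatrix (cellBasis K m i) (cellBasis K m i)).injective
      (Eq.trans ?_ (map_zero _).symm)
    ext d c
    refine toMatrix_eq_zero_of_gen (Subtype.property _) ?_ i c d
    intro i c d hc hcd
    obtain ⟨d, rfl⟩ := d
    refine (congrFun (congrFun (map_sub (LinearMap.toMatrix _ _) _ _) _) _).trans ?_
    rw [Matrix.sub_apply, sub_eq_zero]
    refine (congrFun (congrFun (LinearMap.toMatrix_toLin ..) _) _).trans ?_
    have h4 : c.1.pos ≤ d.pos ∧ d.len + c.1.pos ≤ c.1.len + d.pos := by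
      simp only at hcd
      omega
    rw [endMatrix, dif_pos h4]
    have key : ∀ (g e : m.Cell) (hg : g = c.1) (he : e = d) (h : g.vertex = e.vertex),
        LinearMap.toMatrix (cellBasis K m e.vertex) (cellBasis K m e.vertex) (f.1 e.vertex)
          ⟨e, rfl⟩ ⟨g, h⟩ =
        LinearMap.toMatrix (cellBasis K m d.vertex) (cellBasis K m d.vertex) (f.1 d.vertex)
          ⟨d, rfl⟩ c := by
      rintro g e rfl rfl h
      rfl
    refine key _ _ (Cell.head_eq_self hc) ?_ _
    simp only [hc]
    rfl

theorem endEquiv_apply (B : m.EndIndex → K) (i : ZMod n) :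
    (endEquiv m K B).1 i =
      Matrix.toLin (cellBasis K m i) (cellBasis K m i) (endMatrix B i) := rfl

theorem endDim_eq_card : m.endDim = Fintype.card m.EndIndex := by
  rw [endDim, CyclicRep.endDim, ← (endEquiv m ℂ).finrank_eq, Module.finrank_fintype_fun_eq_card]

/-- The dimension of `Hom` from the indecomposable with label `s` to that with label `t`. -/
def segHom (s t : ℕ × ZMod n) : ℤ :=
  ∑ p ∈ Finset.range t.1, if t.2 - (p : ZMod n) = s.2 ∧ t.1 ≤ s.1 + p then 1 else 0

theorem endDim_eq :
    (m.endDim : ℤ) = m.sum fun s a => (a : ℤ) * m.sum fun t b => (b : ℤ) *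
      segHom (s.1, s.2) (t.1, t.2) := by
  rw [← sum_head fun s => m.sum fun t b => (b : ℤ) * segHom (s.1, s.2) (t.1, t.2),
    endDim_eq_card, Fintype.card_subtype, Finset.card_filter, Fintype.sum_prod_type]
  push_cast
  refine Finset.sum_congr rfl fun g _ => ?_
  split_ifs with h
  · simp only [h, true_and]
    have := sum_cell_of_pos (m := m) fun s p =>
      if s.2 - (p : ZMod n) = g.1.2 ∧ (s.1 : ℕ) ≤ g.len + p then 1 else 0
    refine Eq.trans ?_ this
    refine Finset.sum_congr rfl fun d _ => if_congr ?_ rfl rfl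
    have hg : g.vertex = g.1.2 := by rw [← Cell.vertex_head, Cell.head_eq_self h]
    rw [hg]
    exact and_congr_left fun _ => eq_comm
  · simp [h]

end Multisegment

/-! ### The number of automorphisms -/

namespace Multisegment

variable {n : ℕ} {m : Multisegment n} {K : Type} [Field K]

/-- The cell at position `0` of the copy `a` of the segment `s`. -/
def gen (s : ℕ+ × ZMod n) (a : Fin (m s)) : m.Cell := ⟨s, a, ⟨0, s.1.pos⟩⟩

/-- The diagonal block, for the copies of the segment `s`, of the endomorphism with the
coefficients `B`. -/
def segBlock (B : m.EndIndex → K) (s : ℕ+ × ZMod n) : Matrix (Fin (m s)) (Fin (m s)) K :=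
  fun b a => B ⟨(gen s a, gen s b), rfl, rfl, Nat.le_add_right _ _⟩

/-- The order of the cells for which endomorphisms are block triangular: by the number of steps to
the end of the segment, then by the position. -/
def blockKey {i : ZMod n} (c : {c : m.Cell // c.vertex = i}) : ℕ ×ₗ ℕᵒᵈ :=
  toLex (c.1.len - c.1.pos, OrderDual.toDual c.1.pos)

theorem endMatrix_blockTriangular (B : m.EndIndex → K) (i : ZMod n) :
    (endMatrix B i).BlockTriangular blockKey := by
  intro d c h
  rw [endMatrix, dif_neg]
  rintro ⟨h1, h2⟩
  have hc := c.1.pos_lt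
  have hd := d.1.pos_lt
  rcases Prod.Lex.toLex_lt_toLex.mp h with h3 | ⟨h3, h4⟩
  · simp only at h3
    omega
  · simp only [OrderDual.toDual_lt_toDual] at h4
    omega

/-- In a diagonal block the segments have the same length and the cells the same position and
vertex, so they belong to copies of one segment; the position does not matter. -/
theorem det_toSquareBlock (B : m.EndIndex → K) {i : ZMod n} (c : {c : m.Cell // c.vertex = i}) :
    ((endMatrix B i).toSquareBlock blockKey (blockKey c)).det = (segBlock B c.1.1).det := by
  let e : Fin (m c.1.1) → {d : {d : m.Cell // d.vertex = i} // blockKey d = blockKey c} :=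
    fun a => ⟨⟨⟨c.1.1, a, c.1.2.2⟩, c.2⟩, rfl⟩
  have he : Function.Bijective e := by
    constructor
    · intro a a' h
      have h := Subtype.ext_iff.mp (Subtype.ext_iff.mp h)
      simp only [e, Sigma.mk.injEq, heq_eq_eq, Prod.mk.injEq, true_and, and_true] at h
      exact h
    · rintro ⟨d, hd⟩
      have hd := toLex_inj.mp hd
      simp only [Prod.mk.injEq, EmbeddingLike.apply_eq_iff_eq] at hd
      have hc' := c.1.pos_lt
      have hd' := d.1.pos_lt
      have h1 := Cell.ext_of_vertex (c := c.1) (d := d.1) (by omega) hd.2.symm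
        (c.2.trans d.2.symm)
      obtain ⟨⟨s, a, p⟩, hcv⟩ := c
      obtain ⟨⟨t, b, q⟩, hdv⟩ := d
      simp only at h1
      subst h1
      refine ⟨b, Subtype.ext (Subtype.ext ?_)⟩
      simp only [e, Sigma.mk.injEq, heq_eq_eq, Prod.mk.injEq, true_and]
      exact Fin.ext hd.2.symm
  rw [← Matrix.det_submatrix_equiv_self (Equiv.ofBijective e he)]
  congr 1
  ext b a
  simp only [Matrix.submatrix_apply, Matrix.toSquareBlock_def, Equiv.ofBijective_apply, e,
    Matrix.of_apply, endMatrix]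
  rw [dif_pos ⟨le_rfl, le_rfl⟩, segBlock]
  congr 1
  refine Subtype.ext (Prod.ext rfl ?_)
  simp only [Cell.move, gen, Sigma.mk.injEq, heq_eq_eq, Prod.mk.injEq, Fin.mk.injEq, true_and]
  exact Nat.sub_self _

theorem det_endMatrix_ne_zero (B : m.EndIndex → K) :
    (∀ i, (endMatrix B i).det ≠ 0) ↔ ∀ s, (segBlock B s).det ≠ 0 := by
  simp only [(endMatrix_blockTriangular B _).det, Finset.prod_ne_zero_iff, Finset.mem_image,
    Finset.mem_univ, true_and]
  constructor
  · intro h s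
    rcases Nat.eq_zero_or_pos (m s) with h0 | h0
    · have : IsEmpty (Fin (m s)) := by
        rw [h0]
        infer_instance
      rw [Matrix.det_isEmpty]
      exact one_ne_zero
    · have h1 := h (gen s ⟨0, h0⟩).vertex _ ⟨⟨gen s ⟨0, h0⟩, rfl⟩, rfl⟩
      rw [det_toSquareBlock] at h1
      exact h1
  · rintro h i _ ⟨c, rfl⟩
    rw [det_toSquareBlock]
    exact h _

theorem bijective_endEquiv (B : m.EndIndex → K) :
    (∀ i, Function.Bijective ((endEquiv m K B).1 i)) ↔ ∀ s, (segBlock B s).det ≠ 0 := by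
  rw [← det_endMatrix_ne_zero]
  refine forall_congr' fun i => ?_
  rw [← Module.End.isUnit_iff, endEquiv_apply, Matrix.isUnit_toLin_iff,
    Matrix.isUnit_iff_isUnit_det, isUnit_iff_ne_zero]

/-- Automorphisms are the endomorphisms that are bijective at all vertices. -/
noncomputable def autEquiv (M : CyclicRep K n) :
    CyclicRep.Iso M M ≃ {f : M.endomorphisms // ∀ i, Function.Bijective (f.1 i)} where
  toFun e := ⟨⟨fun i => (e.1 i).toLinearMap, e.2⟩, fun i => (e.1 i).bijective⟩
  invFun f := ⟨fun i => LinearEquiv.ofBijective (f.1.1 i) (f.2 i), f.1.2⟩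
  left_inv _ := Subtype.ext (funext fun _ => LinearEquiv.ext fun _ => rfl)
  right_inv _ := rfl

theorem card_aut_eq : Nat.card (CyclicRep.Iso (m.rep K) (m.rep K)) =
    Nat.card {B : m.EndIndex → K // ∀ s, (segBlock B s).det ≠ 0} := by
  refine Nat.card_congr ((autEquiv _).trans ((endEquiv m K).toEquiv.subtypeEquiv ?_).symm)
  intro B
  exact (bijective_endEquiv B).symm

end Multisegment

/-- Functions on `H` with a condition on their values on the image of an injection `D → H`. -/
theorem card_fun_comp {D H K : Type} [Finite D] [Finite H] [Finite K] {ι : D → H}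
    (hι : Function.Injective ι) (P : (D → K) → Prop) :
    Nat.card {B : H → K // P (B ∘ ι)} =
      Nat.card {β : D → K // P β} * Nat.card K ^ (Nat.card H - Nat.card D) := by
  classical
  have : Fintype D := Fintype.ofFinite D
  have : Fintype H := Fintype.ofFinite H
  let e : (H → K) ≃ (D → K) × ({h // ¬ h ∈ Set.range ι} → K) :=
    (Equiv.piEquivPiSubtypeProd (fun h => h ∈ Set.range ι) fun _ => K).trans
      (Equiv.prodCongr (Equiv.arrowCongr (Equiv.ofInjective ι hι).symm (Equiv.refl K))
        (Equiv.refl _))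
  have he : ∀ B, (e B).1 = B ∘ ι := fun B => rfl
  have e' : {B : H → K // P (B ∘ ι)} ≃
      {β : (D → K) × ({h // ¬ h ∈ Set.range ι} → K) // P β.1} :=
    e.subtypeEquiv fun B => by rw [he]
  have e'' : {β : (D → K) × ({h // ¬ h ∈ Set.range ι} → K) // P β.1} ≃
      {β : D → K // P β} × ({h // ¬ h ∈ Set.range ι} → K) :=
    { toFun := fun b => (⟨b.1.1, b.2⟩, b.1.2)
      invFun := fun b => ⟨(b.1.1, b.2), b.1.2⟩
      left_inv := fun _ => rfl
      right_inv := fun _ => rfl }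
  rw [Nat.card_congr (e'.trans e''), Nat.card_prod, Nat.card_fun]
  congr 2
  rw [Nat.card_eq_fintype_card, Fintype.card_subtype_compl, Nat.card_eq_fintype_card,
    Nat.card_eq_fintype_card, Set.card_range_of_injective hι]

namespace Multisegment

variable {n : ℕ} {m : Multisegment n}

/-- `∑ m_s²`, the dimension of the semisimple quotient of `End K[m]`. -/
def sumSq (m : Multisegment n) : ℕ := m.sum fun _ a => a * a

variable (m) in
/-- The coefficients of the diagonal blocks. -/
def diagIndex (x : Σ s : m.support, Fin (m s) × Fin (m s)) : m.EndIndex :=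
  ⟨(gen x.1 x.2.2, gen x.1 x.2.1), rfl, rfl, Nat.le_add_right _ _⟩

theorem diagIndex_injective : Function.Injective m.diagIndex := by
  rintro ⟨⟨s, hs⟩, a, b⟩ ⟨⟨t, ht⟩, a', b'⟩ h
  simp only [diagIndex, gen, Subtype.mk.injEq, Prod.mk.injEq] at h
  obtain ⟨h1, h2⟩ := h
  obtain ⟨rfl, h1⟩ := Sigma.mk.inj h1
  simp only [Sigma.mk.injEq, heq_eq_eq, Prod.mk.injEq, true_and, and_true] at h1 h2
  rw [h1, h2]

theorem card_diagIndex : Nat.card (Σ s : m.support, Fin (m s) × Fin (m s)) = m.sumSq := by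
  rw [Nat.card_eq_fintype_card, Fintype.card_sigma, sumSq, Finsupp.sum,
    ← Finset.sum_coe_sort m.support]
  simp

theorem sumSq_le_endDim : m.sumSq ≤ m.endDim := by
  rw [← card_diagIndex, endDim_eq_card, ← Nat.card_eq_fintype_card]
  exact Nat.card_le_card_of_injective _ diagIndex_injective

/-- The number of automorphisms of `K[m]` as a polynomial in the number of elements of `K`. -/
noncomputable def autPoly (m : Multisegment n) : ℤ[X] :=
  (∏ s ∈ m.support, ∏ k : Fin (m s), (X ^ m s - X ^ (k : ℕ))) * X ^ (m.endDim - m.sumSq)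

theorem card_matrix_det_ne_zero (K : Type) [Field K] [Finite K] (a : ℕ) :
    (Nat.card {A : Matrix (Fin a) (Fin a) K // A.det ≠ 0} : ℤ) =
      ∏ k : Fin a, ((Nat.card K : ℤ) ^ a - (Nat.card K : ℤ) ^ (k : ℕ)) := by
  have : Fintype K := Fintype.ofFinite K
  let e : Matrix.GeneralLinearGroup (Fin a) K ≃ {A : Matrix (Fin a) (Fin a) K // A.det ≠ 0} :=
    { toFun := fun g => ⟨g.1, (Matrix.GeneralLinearGroup.det g).ne_zero⟩
      invFun := fun A => Matrix.GeneralLinearGroup.mkOfDetNeZero A.1 A.2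
      left_inv := fun g => Units.ext rfl
      right_inv := fun A => rfl }
  rw [← Nat.card_congr e, Matrix.card_GL_field, Nat.card_eq_fintype_card]
  push_cast
  refine Finset.prod_congr rfl fun k _ => ?_
  rw [Nat.cast_sub (Nat.pow_le_pow_right Fintype.card_pos k.2.le)]
  push_cast
  rfl

theorem autPoly_isCountingPolynomial :
    IsCountingPolynomial (fun K _ _ => Nat.card (CyclicRep.Iso (m.rep K) (m.rep K)))
      m.autPoly := by
  intro K _ _
  have h1 : Nat.card {B : m.EndIndex → K // ∀ s, (segBlock B s).det ≠ 0} =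
      Nat.card {β : (Σ s : m.support, Fin (m s) × Fin (m s)) → K //
        ∀ s, (Matrix.of fun b a => β ⟨s, b, a⟩).det ≠ 0} *
      Nat.card K ^ (m.endDim - m.sumSq) := by
    rw [endDim_eq_card, ← card_diagIndex, ← Nat.card_eq_fintype_card,
      ← card_fun_comp diagIndex_injective]
    refine Nat.card_congr (Equiv.subtypeEquivRight fun B => ?_)
    constructor
    · intro h s
      exact h s
    · intro h s
      by_cases hs : s ∈ m.support
      · exact h ⟨s, hs⟩
      · have : IsEmpty (Fin (m s)) := by
          rw [Finsupp.notMem_support_iff.mp hs]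
          infer_instance
        rw [Matrix.det_isEmpty]
        exact one_ne_zero
  have e : {β : (Σ s : m.support, Fin (m s) × Fin (m s)) → K //
        ∀ s, (Matrix.of fun b a => β ⟨s, b, a⟩).det ≠ 0} ≃
      ∀ s : m.support, {A : Matrix (Fin (m s)) (Fin (m s)) K // A.det ≠ 0} :=
    { toFun := fun β s => ⟨Matrix.of fun b a => β.1 ⟨s, b, a⟩, β.2 s⟩
      invFun := fun A => ⟨fun x => (A x.1).1 x.2.1 x.2.2, fun s => (A s).2⟩
      left_inv := fun _ => rfl
      right_inv := fun _ => rfl }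
  change _ = (Nat.card (CyclicRep.Iso (m.rep K) (m.rep K)) : ℤ)
  rw [card_aut_eq, h1, Nat.card_congr e, Nat.card_pi, autPoly]
  push_cast
  simp only [card_matrix_det_ne_zero, eval_mul, eval_prod, eval_sub, eval_pow, eval_X]
  rw [Finset.prod_coe_sort m.support fun s => ∏ k : Fin (m s),
    ((Nat.card K : ℤ) ^ m s - (Nat.card K : ℤ) ^ (k : ℕ))]

end Multisegment

/-- A polynomial is determined by its values at the orders of the finite fields. -/
theorem IsCountingPolynomial.unique {c : ∀ (K : Type) [Field K] [Finite K], ℕ} {F G : ℤ[X]}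
    (hF : IsCountingPolynomial c F) (hG : IsCountingPolynomial c G) : F = G := by
  refine Polynomial.eq_of_infinite_eval_eq F G ?_
  have hp : (Set.range fun p : Nat.Primes => (p : ℤ)).Infinite :=
    Set.infinite_range_of_injective fun p q h => by
      simp only [Nat.cast_inj] at h
      exact Subtype.ext h
  refine hp.mono ?_
  rintro _ ⟨⟨p, hp⟩, rfl⟩
  have : Fact p.Prime := ⟨hp⟩
  have h1 := hF (ZMod p)
  have h2 := hG (ZMod p)
  rw [Nat.card_zmod] at h1 h2
  exact h1.trans h2.symm

theorem IsCountingPolynomial.countingPolynomial_eq {c : ∀ (K : Type) [Field K] [Finite K], ℕ}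
    {F : ℤ[X]} (hF : IsCountingPolynomial c F) : countingPolynomial c = F := by
  have h : ∃ F, IsCountingPolynomial c F := ⟨F, hF⟩
  rw [countingPolynomial, dif_pos h]
  exact h.choose_spec.unique hF

theorem Multisegment.autPolynomial_eq {n : ℕ} (m : Multisegment n) :
    m.autPolynomial = m.autPoly :=
  Multisegment.autPoly_isCountingPolynomial.countingPolynomial_eq

/-! ### The multisegment is determined by the representation -/

namespace Multisegment

variable {n : ℕ}

theorem segDim_succ (j i : ZMod n) (ℓ : ℕ) :
    segDim j (ℓ + 1, i) = segDim j (ℓ, i - 1) + if i = j then 1 else 0 := by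
  simp only [segDim, Finset.sum_range_succ', Nat.cast_zero, sub_zero]
  congr 1
  refine Finset.sum_congr rfl fun p _ => if_congr ?_ rfl rfl
  push_cast
  rw [sub_sub, add_comm]

/-- The maps to the longer segment that do not come from its radical are the surjective ones. -/
theorem segHom_succ_right (t : ℕ × ZMod n) (i : ZMod n) (ℓ : ℕ) :
    segHom t (ℓ + 1, i) = segHom t (ℓ, i - 1) + if i = t.2 ∧ ℓ + 1 ≤ t.1 then 1 else 0 := by
  simp only [segHom, Finset.sum_range_succ', Nat.cast_zero, sub_zero, add_zero]
  congr 1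
  refine Finset.sum_congr rfl fun p _ => if_congr (and_congr ?_ (by omega)) rfl rfl
  push_cast
  rw [sub_sub, add_comm]

/-- The kernel of `x ^ (ℓ + 1)` at `i` is mapped by `x` to that of `x ^ ℓ` at `i - 1`; the formula
compares dimensions through the kernel and the cokernel of this map. -/
theorem segHom_succ_left (t : ℕ × ZMod n) (i : ZMod n) (ℓ : ℕ) :
    segHom (ℓ + 1, i) t = segHom (ℓ, i - 1) t + segDim i t - segDim (i - 1) t +
      if t.2 = i - 1 ∧ ℓ + 1 ≤ t.1 then 1 else 0 := by
  obtain ⟨L, j⟩ := t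
  have shift : ∀ p : ℕ, j - ((p + 1 : ℕ) : ZMod n) = i - 1 ↔ j - (p : ZMod n) = i := by
    intro p
    push_cast
    rw [← sub_sub, sub_left_inj]
  have h1 := Finset.sum_range_succ
    (fun p : ℕ => if j - (p : ZMod n) = i - 1 ∧ L ≤ ℓ + p then (1 : ℤ) else 0) L
  rw [Finset.sum_range_succ'] at h1
  have h2 := Finset.sum_range_succ
    (fun p : ℕ => if j - (p : ZMod n) = i - 1 then (1 : ℤ) else 0) L
  rw [Finset.sum_range_succ'] at h2
  simp only [shift, Nat.cast_zero, sub_zero, add_zero] at h1 h2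
  have h3 : ∀ p, L ≤ ℓ + (p + 1) ↔ L ≤ ℓ + 1 + p := fun p => by omega
  simp only [h3, Nat.le_add_left, and_true] at h1
  simp only [segHom, segDim]
  have h4 : (if j = i - 1 then (1 : ℤ) else 0) = (if j = i - 1 ∧ L ≤ ℓ then 1 else 0) +
      if j = i - 1 ∧ ℓ + 1 ≤ L then 1 else 0 := by
    by_cases h : j = i - 1 <;> by_cases h' : L ≤ ℓ <;> simp [h, h']
  linarith

theorem segHom_zero_left (i : ZMod n) (t : ℕ × ZMod n) : segHom (0, i) t = 0 := by
  refine Finset.sum_eq_zero fun p hp => if_neg ?_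
  rw [Finset.mem_range] at hp
  simp only
  omega

theorem segHom_zero_right (i : ZMod n) (t : ℕ × ZMod n) : segHom t (0, i) = 0 := rfl

theorem segDim_zero (j i : ZMod n) : segDim j (0, i) = 0 := rfl

end Multisegment

/-- The kernel of the `k`-th power of `x` at the vertex `j`. -/
def CyclicRep.kerPow {K : Type} [Field K] {n : ℕ} (M : CyclicRep K n) :
    ℕ → ∀ j, Submodule K (M.V j)
  | 0, _ => ⊥
  | k + 1, j => (kerPow M k (j - 1)).comap (M.x j)

theorem CyclicRep.Iso.finrank_kerPow {K : Type} [Field K] {n : ℕ} {M N : CyclicRep K n}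
    (e : CyclicRep.Iso M N) (k : ℕ) (j : ZMod n) :
    Module.finrank K (M.kerPow k j) = Module.finrank K (N.kerPow k j) := by
  have h : ∀ k j w, e.1 j w ∈ N.kerPow k j ↔ w ∈ M.kerPow k j := by
    intro k
    induction k with
    | zero =>
      intro j w
      exact (e.1 j).map_eq_zero_iff
    | succ k ih =>
      intro j w
      simp only [kerPow, Submodule.mem_comap]
      rw [← ih]
      exact iff_of_eq (congrArg (· ∈ N.kerPow k (j - 1)) (LinearMap.congr_fun (e.2 j) w))
  have h1 : (M.kerPow k j).map (e.1 j).toLinearMap = N.kerPow k j := by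
    ext w
    rw [Submodule.mem_map]
    constructor
    · rintro ⟨w, hw, rfl⟩
      exact (h k j w).mpr hw
    · intro hw
      refine ⟨(e.1 j).symm w, (h k j _).mp ?_, (e.1 j).apply_symm_apply w⟩
      rwa [LinearEquiv.apply_symm_apply]
  rw [← h1]
  exact (LinearEquiv.finrank_map_eq (e.1 j) _).symm

namespace Multisegment

variable {n : ℕ} {m : Multisegment n} {K : Type} [Field K]

theorem mem_kerPow (k : ℕ) (j : ZMod n) (w : (m.rep K).V j) :
    w ∈ (m.rep K).kerPow k j ↔
      ∀ c : {c : m.Cell // c.vertex = j}, k + c.1.pos < c.1.len →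
        (cellBasis K m j).repr w c = 0 := by
  induction k generalizing j with
  | zero =>
    simp only [CyclicRep.kerPow, Submodule.mem_bot]
    constructor
    · rintro rfl c _
      simp
    · intro h
      refine (cellBasis K m j).repr.map_eq_zero_iff.mp (Finsupp.ext fun c => ?_)
      have := c.1.pos_lt
      exact h c (by omega)
  | succ k ih =>
    simp only [CyclicRep.kerPow, Submodule.mem_comap, ih, repr_x]
    constructor
    · intro h c hc
      have := h ⟨c.1.move (c.1.pos + 1) (by omega), next_vertex c _⟩
        (show k + (c.1.pos + 1) < c.1.len by omega)
      rw [dif_pos (show 0 < (c.1.move (c.1.pos + 1) (by omega)).pos from Nat.succ_pos _)] at this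
      exact this
    · intro h d hd
      split_ifs with h0
      · refine h _ ?_
        change k + 1 + (d.1.pos - 1) < d.1.len
        omega
      · rfl

theorem finrank_kerPow (k : ℕ) (j : ZMod n) :
    (Module.finrank K ((m.rep K).kerPow k j) : ℤ) =
      m.sum fun t b => (b : ℤ) * segHom (k, j) (t.1, t.2) := by
  have h1 : ((m.rep K).kerPow k j).map (cellBasis K m j).repr.toLinearMap =
      Finsupp.supported K K {c : {c : m.Cell // c.vertex = j} | c.1.len ≤ k + c.1.pos} := by
    ext w
    rw [Submodule.mem_map, Finsupp.mem_supported']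
    constructor
    · rintro ⟨w, hw, rfl⟩ c hc
      exact (mem_kerPow k j w).mp hw c (not_le.mp hc)
    · intro hw
      refine ⟨(cellBasis K m j).repr.symm w, (mem_kerPow k j _).mpr fun c hc => ?_,
        LinearEquiv.apply_symm_apply _ _⟩
      rw [LinearEquiv.apply_symm_apply]
      exact hw c (not_le.mpr hc)
  have h2 := LinearEquiv.finrank_map_eq (cellBasis K m j).repr ((m.rep K).kerPow k j)
  have h3 : Module.finrank K (Finsupp.supported K K
      {c : {c : m.Cell // c.vertex = j} | c.1.len ≤ k + c.1.pos}) =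
      Fintype.card {c : {c : m.Cell // c.vertex = j} // c.1.len ≤ k + c.1.pos} := by
    rw [(Finsupp.supportedEquivFinsupp _).finrank_eq, Module.finrank_finsupp_self]
    rfl
  rw [← h2]
  refine (congrArg (fun U : Submodule K ({c : m.Cell // c.vertex = j} →₀ K) =>
    (Module.finrank K U : ℤ)) h1).trans ?_
  rw [h3, Fintype.card_congr (Equiv.subtypeSubtypeEquivSubtypeInter (fun c => c.vertex = j)
    fun c : m.Cell => c.len ≤ k + c.pos), Fintype.card_subtype, Finset.card_filter]
  push_cast
  exact sum_cell_of_pos fun s p =>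
    if s.2 - (p : ZMod n) = j ∧ (s.1 : ℕ) ≤ k + p then 1 else 0

/-- The multiplicities are second differences of the dimensions of the kernels of powers of
`x`. -/
theorem apply_eq (m : Multisegment n) (k : ℕ+) (j : ZMod n) :
    (m (k, j) : ℤ) =
      (m.sum fun t b => (b : ℤ) * segHom (k, j) (t.1, t.2)) -
      (m.sum fun t b => (b : ℤ) * segHom ((k : ℕ) - 1, j) (t.1, t.2)) -
      ((m.sum fun t b => (b : ℤ) * segHom (k + 1, j + 1) (t.1, t.2)) -
        m.sum fun t b => (b : ℤ) * segHom (k, j + 1) (t.1, t.2)) := by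
  have h : ∀ t : ℕ+ × ZMod n, segHom ((k : ℕ), j) (t.1, t.2) -
      segHom ((k : ℕ) - 1, j) (t.1, t.2) - (segHom ((k : ℕ) + 1, j + 1) (t.1, t.2) -
      segHom ((k : ℕ), j + 1) (t.1, t.2)) = if t = (k, j) then 1 else 0 := by
    intro t
    have h1 := segHom_succ_left (↑t.1, t.2) (j + 1) k
    have h2 := segHom_succ_left (↑t.1, t.2) (j + 1) ((k : ℕ) - 1)
    rw [Nat.sub_add_cancel k.pos] at h2
    rw [h1, h2]
    simp only [add_sub_cancel_right]
    have h3 : (if t.2 = j ∧ (k : ℕ) ≤ t.1 then (1 : ℤ) else 0) =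
        (if t.2 = j ∧ (k : ℕ) + 1 ≤ t.1 then 1 else 0) + if t = (k, j) then 1 else 0 := by
      obtain ⟨l, i⟩ := t
      by_cases hi : i = j
      · simp only [hi, true_and, Prod.mk.injEq, and_true, ← PNat.coe_inj]
        split_ifs <;> omega
      · simp [hi]
    linarith
  simp only [Finsupp.sum, ← Finset.sum_sub_distrib, ← mul_sub, h]
  simp

theorem eq_of_iso {p p' : Multisegment n} (e : CyclicRep.Iso (p.rep K) (p'.rep K)) : p = p' := by
  refine Finsupp.ext fun s => ?_
  have h := fun k j => congrArg (Nat.cast : ℕ → ℤ) (e.finrank_kerPow k j)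
  simp only [finrank_kerPow] at h
  have h1 := apply_eq p s.1 s.2
  rw [h, h, h, h, ← apply_eq] at h1
  exact_mod_cast h1

end Multisegment

/-! ### Removing the head of a segment -/

namespace Multisegment

variable {n : ℕ} {m : Multisegment n}

theorem coe_pred {ℓ : ℕ+} (h : ℓ ≠ 1) : ((ℓ - 1 : ℕ+) : ℕ) = (ℓ : ℕ) - 1 := by
  rw [PNat.sub_coe, if_pos (lt_of_le_of_ne one_le h.symm)]
  rfl

/-- The multiplicities in `m⁻_{ℓ,i}`. For `ℓ = 1` the label `(ℓ - 1, i - 1)` is of length `0` and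
does not occur. -/
theorem minus_apply {ℓ : ℕ+} {i : ZMod n} (h : m (ℓ, i) ≠ 0) (s : ℕ+ × ZMod n) :
    (CyclicHall.minus m ℓ i s : ℤ) = m s - (if (ℓ, i) = s then 1 else 0) +
      if ((ℓ : ℕ) - 1, i - 1) = ((s.1 : ℕ), s.2) then 1 else 0 := by
  have h1 : (((m - Finsupp.single (ℓ, i) 1 : Multisegment n) s : ℕ) : ℤ) =
      m s - if (ℓ, i) = s then 1 else 0 := by
    rw [Finsupp.tsub_apply, Finsupp.single_apply]
    split_ifs with hs
    · subst hs
      omega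
    · simp
  by_cases hℓ : ℓ = 1
  · subst hℓ
    rw [CyclicHall.minus, if_pos rfl, h1, left_eq_add, if_neg]
    intro h2
    have := s.1.pos
    have h3 := congrArg Prod.fst h2
    simp only [PNat.val_ofNat] at h3
    omega
  · rw [CyclicHall.minus, if_neg hℓ, Finsupp.add_apply, Nat.cast_add, h1,
      Finsupp.single_apply, ← coe_pred hℓ]
    congr 1
    push_cast
    refine if_congr ?_ rfl rfl
    rw [Prod.ext_iff, Prod.ext_iff, ← PNat.coe_inj]

/-- The copies of the segments of `m`. -/
abbrev Copy (m : Multisegment n) : Type := Σ s : ℕ+ × ZMod n, Fin (m s)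

instance : Finite m.Copy :=
  Finite.of_injective (fun g : m.Copy => (gen g.1 g.2 : m.Cell)) fun g g' h => by
    obtain ⟨s, a⟩ := g
    obtain ⟨t, b⟩ := g'
    obtain ⟨rfl, h⟩ := Sigma.mk.inj h
    simp only [heq_eq_eq, Prod.mk.injEq, and_true] at h
    rw [h]

noncomputable instance : Fintype m.Copy := Fintype.ofFinite _

/-- The labels of the segments after the head of the copy `g₀` has been removed. (The length may
become `0`.) -/
def cutLabel (g₀ g : m.Copy) : ℕ × ZMod n :=
  if g = g₀ then ((g.1.1 : ℕ) - 1, g.1.2 - 1) else (g.1.1, g.1.2)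

/-- The number of cells that have been removed from the copy `g`. -/
def cutShift (g₀ g : m.Copy) : ℕ := if g = g₀ then 1 else 0

theorem cutLabel_fst (g₀ g : m.Copy) : (cutLabel g₀ g).1 + cutShift g₀ g = g.1.1 := by
  have := g.1.1.pos
  rw [cutLabel, cutShift]
  split_ifs
  · simp only
    omega
  · rfl

theorem cutLabel_snd (g₀ g : m.Copy) :
    (cutLabel g₀ g).2 = g.1.2 - (cutShift g₀ g : ZMod n) := by
  rw [cutLabel, cutShift]
  split_ifs <;> simp

theorem card_copy (s : ℕ+ × ZMod n) :
    ∑ g : m.Copy, (if g.1 = s then (1 : ℤ) else 0) = m s := by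
  rw [Finset.sum_boole, ← Fintype.card_subtype, Fintype.card_congr (Equiv.sigmaSubtype s),
    Fintype.card_fin]

theorem card_cutLabel (g₀ : m.Copy) (s : ℕ+ × ZMod n) :
    Fintype.card {g : m.Copy // cutLabel g₀ g = (↑s.1, s.2)} =
      CyclicHall.minus m g₀.1.1 g₀.1.2 s := by
  have h0 : m (g₀.1.1, g₀.1.2) ≠ 0 := (lt_of_le_of_lt (Nat.zero_le _) g₀.2.2).ne'
  zify
  rw [minus_apply h0, Fintype.card_subtype, Finset.card_filter, ← card_copy]
  push_cast
  have h1 : ∀ g : m.Copy, (if cutLabel g₀ g = (↑s.1, s.2) then (1 : ℤ) else 0) =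
      (if g.1 = s then (1 : ℤ) else 0) - (if g = g₀ then (if g₀.1 = s then 1 else 0) else 0) +
      if g = g₀ then (if ((g₀.1.1 : ℕ) - 1, g₀.1.2 - 1) = ((s.1 : ℕ), s.2) then 1 else 0)
        else 0 := by
    intro g
    rw [cutLabel]
    by_cases hg : g = g₀
    · subst hg
      simp
    · simp only [if_neg hg, sub_zero, add_zero]
      refine if_congr ?_ rfl rfl
      rw [Prod.ext_iff, Prod.ext_iff, ← PNat.coe_inj]
  simp only [h1, Finset.sum_add_distrib, Finset.sum_sub_distrib, Finset.sum_ite_eq',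
    Finset.mem_univ, if_true, Prod.mk.eta]

/-- The cells of `m⁻_{ℓ,i}` are the cells of `m` except for one cell at position `0` of a copy of
`(ℓ; i]`. -/
theorem exists_cell_embedding (c₀ : m.Cell) (h₀ : c₀.pos = 0) :
    ∃ e : (CyclicHall.minus m c₀.1.1 c₀.1.2).Cell → m.Cell, Function.Injective e ∧
      (∀ d, (e d).vertex = d.vertex) ∧ (∀ d, e d ≠ c₀) ∧ (∀ c, c ≠ c₀ → ∃ d, e d = c) ∧
      (∀ d (h : 0 < d.pos), 0 < (e d).pos ∧
        (e d).move ((e d).pos - 1) (by have := (e d).pos_lt; omega) =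
          e (d.move (d.pos - 1) (by have := d.pos_lt; omega))) ∧
      ∀ d, d.pos = 0 → 0 < (e d).pos →
        (e d).move ((e d).pos - 1) (by have := (e d).pos_lt; omega) = c₀ := by
  let g₀ : m.Copy := ⟨c₀.1, c₀.2.1⟩
  -- the copies of `m⁻_{ℓ,i}` are those of `m`, with the shortened labels
  let E : ∀ s, Fin (CyclicHall.minus m c₀.1.1 c₀.1.2 s) ≃
      {g : m.Copy // cutLabel g₀ g = (↑s.1, s.2)} := fun s =>
    Fintype.equivOfCardEq (by rw [Fintype.card_fin, ← card_cutLabel g₀ s])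
  have hE : ∀ s a, cutLabel g₀ (E s a).1 = (↑s.1, s.2) := fun s a => (E s a).2
  let e : (CyclicHall.minus m c₀.1.1 c₀.1.2).Cell → m.Cell := fun d =>
    ⟨(E d.1 d.2.1).1.1, (E d.1 d.2.1).1.2, ⟨d.pos + cutShift g₀ (E d.1 d.2.1).1, by
      have h1 : (d.1.1 : ℕ) + _ = _ :=
        (congrArg (·.1 + _) (hE _ _)).symm.trans (cutLabel_fst g₀ (E d.1 d.2.1).1)
      have h2 : d.pos < (d.1.1 : ℕ) := d.pos_lt
      omega⟩⟩
  have e_pos : ∀ d, (e d).pos = d.pos + cutShift g₀ (E d.1 d.2.1).1 := fun _ => rfl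
  have e_copy : ∀ d, (⟨(e d).1, (e d).2.1⟩ : m.Copy) = (E d.1 d.2.1).1 := fun _ => rfl
  have c₀_eq : ∀ c : m.Cell, (⟨c.1, c.2.1⟩ : m.Copy) = g₀ → c.pos = 0 → c = c₀ := by
    rintro ⟨s, a, p⟩ hc hp
    obtain ⟨t, b, q⟩ := c₀
    obtain ⟨rfl, hc⟩ := Sigma.mk.inj hc
    simp only [heq_eq_eq] at hc
    simp only [hc, Sigma.mk.injEq, heq_eq_eq, Prod.mk.injEq, true_and]
    exact Fin.ext (hp.trans h₀.symm)
  refine ⟨e, ?_, ?_, ?_, ?_, ?_, ?_⟩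
  · intro d d' h
    have h1 : (E d.1 d.2.1).1 = (E d'.1 d'.2.1).1 := by
      rw [← e_copy, ← e_copy, h]
    have h2 : d.1 = d'.1 := by
      have h3 := hE d.1 d.2.1
      rw [h1, hE] at h3
      exact Prod.ext (PNat.eq (congrArg Prod.fst h3).symm) (congrArg Prod.snd h3).symm
    have h3 : d.pos = d'.pos := by
      have h4 := e_pos d
      rw [h, e_pos, h1] at h4
      omega
    obtain ⟨s, a, p⟩ := d
    obtain ⟨t, b, q⟩ := d'
    simp only at h1 h2
    subst h2
    have h4 := (E s).injective (Subtype.ext h1)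
    simp only [h4, Sigma.mk.injEq, heq_eq_eq, Prod.mk.injEq, true_and]
    exact Fin.ext h3
  · intro d
    rw [Cell.vertex_eq, Cell.vertex_eq, e_pos]
    have h1 : d.1.2 = _ - _ :=
      (congrArg Prod.snd (hE _ _)).symm.trans (cutLabel_snd g₀ (E d.1 d.2.1).1)
    refine Eq.trans ?_ (congrArg (· - (d.pos : ZMod n)) h1.symm)
    simp only [e]
    push_cast
    ring
  · intro d h
    have h1 : (E d.1 d.2.1).1 = g₀ := by
      rw [← e_copy, h]
    have h2 := e_pos d
    rw [h, h₀, h1, cutShift, if_pos rfl] at h2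
    omega
  · intro c hc
    have h1 : cutShift g₀ ⟨c.1, c.2.1⟩ ≤ c.pos := by
      rw [cutShift]
      split_ifs with h
      · by_contra h2
        exact hc (c₀_eq c h (by omega))
      · omega
    have h2 : _ + _ = (c.1.1 : ℕ) := cutLabel_fst g₀ ⟨c.1, c.2.1⟩
    have h3 : c.pos < (c.1.1 : ℕ) := c.pos_lt
    have h4 : 0 < (cutLabel g₀ ⟨c.1, c.2.1⟩).1 := by omega
    let s : ℕ+ × ZMod n :=
      (⟨(cutLabel g₀ ⟨c.1, c.2.1⟩).1, h4⟩, (cutLabel g₀ ⟨c.1, c.2.1⟩).2)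
    have h5 : (E s ((E s).symm ⟨⟨c.1, c.2.1⟩, rfl⟩)).1 = ⟨c.1, c.2.1⟩ := by
      rw [Equiv.apply_symm_apply]
    let d : (CyclicHall.minus m c₀.1.1 c₀.1.2).Cell :=
      ⟨s, (E s).symm ⟨⟨c.1, c.2.1⟩, rfl⟩, ⟨c.pos - cutShift g₀ ⟨c.1, c.2.1⟩, by
        simp only [s, PNat.mk_coe]
        omega⟩⟩
    refine ⟨d, ?_⟩
    have h6 := (e_copy d).trans h5
    have h7 := e_pos d
    rw [show (E d.1 d.2.1).1 = ⟨c.1, c.2.1⟩ from h5] at h7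
    have h8 : (e d).pos = c.pos := by
      rw [h7]
      exact Nat.sub_add_cancel h1
    generalize e d = c' at h6 h8
    obtain ⟨s, a, p⟩ := c
    obtain ⟨t, b, q⟩ := c'
    obtain ⟨rfl, h6⟩ := Sigma.mk.inj h6
    simp only [heq_eq_eq] at h6
    simp only [h6, Sigma.mk.injEq, heq_eq_eq, Prod.mk.injEq, true_and]
    exact Fin.ext h8
  · intro d h
    refine ⟨by rw [e_pos]; omega, ?_⟩
    simp only [e, Cell.move, Sigma.mk.injEq, heq_eq_eq, Prod.mk.injEq, Fin.mk.injEq, true_and]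
    change d.pos + _ - 1 = d.pos - 1 + _
    omega
  · intro d h h1
    rw [e_pos, h, zero_add, cutShift] at h1
    split_ifs at h1 with h2
    · refine c₀_eq _ ((e_copy d).trans h2) ?_
      change (e d).pos - 1 = 0
      rw [e_pos, h, h2, cutShift, if_pos rfl]
    · omega

end Multisegment

/-! ### Kernels of functionals on the head -/

namespace Multisegment

variable {n : ℕ} {m : Multisegment n} {K : Type} [Field K]

/-- The cells at position `0` at the vertex `i`. They represent a basis of the head of `K[m]` at
`i`. -/
abbrev HeadCell (m : Multisegment n) (i : ZMod n) : Type :=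
  {c : m.Cell // c.pos = 0 ∧ c.vertex = i}

variable {i : ZMod n}

/-- The functional on `K[m]` at the vertex `j` that is induced by a functional on the head at `i`.
It vanishes if `j ≠ i`. -/
noncomputable def headForm (ψ : m.HeadCell i → K) (j : ZMod n) : (m.rep K).V j →ₗ[K] K :=
  (cellBasis K m j).constr K fun c => if h : c.1.pos = 0 ∧ c.1.vertex = i then ψ ⟨c.1, h⟩ else 0

theorem headForm_cellBasis (ψ : m.HeadCell i → K) (j : ZMod n)
    (c : {c : m.Cell // c.vertex = j}) :
    headForm ψ j (cellBasis K m j c) =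
      if h : c.1.pos = 0 ∧ c.1.vertex = i then ψ ⟨c.1, h⟩ else 0 :=
  (cellBasis K m j).constr_basis K _ c

theorem headForm_x (ψ : m.HeadCell i → K) (j : ZMod n) (w : (m.rep K).V j) :
    headForm ψ (j - 1) ((m.rep K).x j w) = 0 := by
  have h : headForm ψ (j - 1) ∘ₗ (m.rep K).x j = 0 := by
    refine (cellBasis K m j).ext fun c => ?_
    rw [LinearMap.comp_apply, x_cellBasis]
    split_ifs with h
    · rw [headForm_cellBasis, dif_neg]
      · rfl
      · exact fun h' => Nat.succ_ne_zero _ h'.1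
    · simp
  exact LinearMap.congr_fun h w

theorem headForm_of_ne (ψ : m.HeadCell i → K) {j : ZMod n} (h : j ≠ i) : headForm ψ j = 0 := by
  refine (cellBasis K m j).ext fun c => ?_
  rw [headForm_cellBasis, dif_neg]
  · rfl
  · exact fun h' => h (c.2.symm.trans h'.2)

theorem headForm_smul (a : K) (ψ : m.HeadCell i → K) (j : ZMod n) :
    headForm (a • ψ) j = a • headForm ψ j := by
  refine (cellBasis K m j).ext fun c => ?_
  rw [LinearMap.smul_apply, headForm_cellBasis, headForm_cellBasis]
  split_ifs <;> simp

theorem headForm_injective :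
    Function.Injective fun ψ : m.HeadCell i → K => headForm ψ i := by
  intro ψ ψ' h
  funext c
  have h1 := LinearMap.congr_fun h (cellBasis K m i ⟨c.1, c.2.2⟩)
  simp only [headForm_cellBasis] at h1
  rw [dif_pos c.2, dif_pos c.2] at h1
  exact h1

theorem headForm_ne_zero {ψ : m.HeadCell i → K} (h : ψ ≠ 0) : headForm ψ i ≠ 0 := by
  intro h1
  refine h (headForm_injective ?_)
  refine h1.trans ?_
  have := headForm_smul (0 : K) ψ i
  rw [zero_smul, zero_smul] at this
  exact this.symm

/-- The subrepresentation on which a functional on the head vanishes. -/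
noncomputable def headSub (ψ : m.HeadCell i → K) : CyclicRep.Subrep (m.rep K) where
  U j := LinearMap.ker (headForm ψ j)
  map_mem j w _ := headForm_x ψ j w

/-- The coefficients of an endomorphism whose composition with the coordinate at `c₀` is the
functional given by `ψ`, if `ψ` vanishes on the segments that are shorter than that of `c₀`. The
generator `g` is sent to itself plus `ψ g` times `c₀`, and `c₀` to `ψ c₀` times itself. -/
def straighten (ψ : m.HeadCell i → K) (c₀ : m.Cell) (hv : c₀.vertex = i) (gd : m.EndIndex) : K :=
  if h : gd.1.2 = c₀ then ψ ⟨gd.1.1, gd.2.1, by rw [gd.2.2.1, h, hv]⟩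
  else if gd.1.1 = gd.1.2 then 1 else 0

theorem gen_injective (s : ℕ+ × ZMod n) : Function.Injective (gen s : Fin (m s) → m.Cell) := by
  intro a b h
  simpa [gen] using h

/-- Each diagonal block is an identity matrix, except that the row of `c₀` consists of the values of
`ψ`; it is invertible since `ψ c₀ ≠ 0`. -/
theorem bijective_straighten {ψ : m.HeadCell i → K} {c₀ : m.Cell} (h₀ : c₀.pos = 0)
    (hv : c₀.vertex = i) (hψ : ψ ⟨c₀, h₀, hv⟩ ≠ 0) (j : ZMod n) :
    Function.Bijective ((endEquiv m K (straighten ψ c₀ hv)).1 j) := by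
  revert j
  rw [bijective_endEquiv]
  intro s h
  obtain ⟨v, hv0, hv1⟩ := Matrix.exists_mulVec_eq_zero_iff.mpr h
  refine hv0 (funext fun b => ?_)
  have h1 : ∀ b, gen s b ≠ c₀ → v b = 0 := by
    intro b hb
    have h2 := congrFun hv1 b
    simp only [Matrix.mulVec, dotProduct, segBlock, straighten, dif_neg hb,
      (gen_injective s).eq_iff, ite_mul, one_mul, zero_mul, Finset.sum_ite_eq',
      Finset.mem_univ, if_true] at h2
    exact h2
  by_cases hb : gen s b = c₀
  · have h2 := congrFun hv1 b
    simp only [Matrix.mulVec, dotProduct] at h2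
    rw [Finset.sum_eq_single b] at h2
    · simp only [segBlock, straighten, hb] at h2
      exact (mul_eq_zero.mp h2).resolve_left hψ
    · intro a _ hab
      rw [h1 a fun ha => hab (gen_injective s (ha.trans hb.symm)), mul_zero]
    · simp
  · exact h1 b hb

theorem repr_straighten {ψ : m.HeadCell i → K} {c₀ : m.Cell} (h₀ : c₀.pos = 0)
    (hv : c₀.vertex = i) (hmin : ∀ c : m.HeadCell i, c.1.len < c₀.len → ψ c = 0)
    (w : (m.rep K).V i) :
    (cellBasis K m i).repr ((endEquiv m K (straighten ψ c₀ hv)).1 i w) ⟨c₀, hv⟩ =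
      headForm ψ i w := by
  have h : (cellBasis K m i).coord ⟨c₀, hv⟩ ∘ₗ (endEquiv m K (straighten ψ c₀ hv)).1 i =
      headForm ψ i := by
    refine (cellBasis K m i).ext fun c => ?_
    rw [LinearMap.comp_apply, Module.Basis.coord_apply, endEquiv_apply, headForm_cellBasis,
      ← LinearMap.toMatrix_apply, LinearMap.toMatrix_toLin, endMatrix]
    have hc := c.1.pos_lt
    by_cases hp : c.1.pos = 0
    · rw [dif_pos (show c.1.pos = 0 ∧ c.1.vertex = i from ⟨hp, c.2⟩)]
      by_cases hl : c.1.len < c₀.len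
      · rw [hmin ⟨c.1, hp, c.2⟩ hl, dif_neg]
        rintro ⟨h1, h2⟩
        simp only at h1 h2
        omega
      · have h2 : c.1.pos ≤ c₀.pos ∧ c₀.len + c.1.pos ≤ c.1.len + c₀.pos := by omega
        have h3 : c₀.move (c₀.pos - c.1.pos) (by have := c₀.pos_lt; omega) = c₀ := by
          simp only [hp]
          rfl
        rw [dif_pos h2, straighten, dif_pos h3]
        simp only [Cell.head_eq_self hp]
    · rw [dif_neg, dif_neg]
      · exact fun h => hp h.1
      · rintro ⟨h1, h2⟩
        simp only at h1
        omega
  exact LinearMap.congr_fun h w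

/-- If `ℓ` is the least length of a segment on whose head `ψ` does not vanish, then the
subrepresentation on which `ψ` vanishes is of type `m⁻_{ℓ,i}`. -/
theorem headSub_iso {ψ : m.HeadCell i → K} {c₀ : m.Cell} (h₀ : c₀.pos = 0)
    (hv : c₀.vertex = i) (hψ : ψ ⟨c₀, h₀, hv⟩ ≠ 0)
    (hmin : ∀ c : m.HeadCell i, c.1.len < c₀.len → ψ c = 0) :
    Nonempty (CyclicRep.Iso (headSub ψ).toRep
      ((CyclicHall.minus m c₀.1.1 c₀.1.2).rep K)) := by
  set p := CyclicHall.minus m c₀.1.1 c₀.1.2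
  obtain ⟨e, e_inj, e_vertex, e_ne, e_surj, e_pred, e_cut⟩ := exists_cell_embedding c₀ h₀
  set θ := endEquiv m K (straighten ψ c₀ hv) with hθ
  have θ_bij : ∀ j, Function.Bijective (θ.1 j) := bijective_straighten h₀ hv hψ
  let f : ∀ j, {c : p.Cell // c.vertex = j} → {c : m.Cell // c.vertex = j} :=
    fun j c => ⟨e c.1, (e_vertex c.1).trans c.2⟩
  have f_inj : ∀ j, Function.Injective (f j) := fun j c c' h =>
    Subtype.ext (e_inj (Subtype.ext_iff.mp h))
  -- `π` forgets the coordinate at `c₀`; it commutes with `x` where that coordinate vanishes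
  let π : ∀ j, (m.rep K).V j →ₗ[K] (p.rep K).V j := fun j =>
    (cellBasis K p j).repr.symm.toLinearMap ∘ₗ Finsupp.lcomapDomain (f j) (f_inj j) ∘ₗ
      (cellBasis K m j).repr.toLinearMap
  have repr_π : ∀ j w c, (cellBasis K p j).repr (π j w) c = (cellBasis K m j).repr w (f j c) := by
    intro j w c
    simp only [π, LinearMap.comp_apply, LinearEquiv.coe_coe, LinearEquiv.apply_symm_apply]
    rfl
  have θ_zero : ∀ j (h : c₀.vertex = j) (w : (m.rep K).V j), headForm ψ j w = 0 →
      (cellBasis K m j).repr (θ.1 j w) ⟨c₀, h⟩ = 0 := by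
    intro j h w hw
    obtain rfl : i = j := hv.symm.trans h
    exact (repr_straighten h₀ hv hmin w).trans hw
  have π_x : ∀ j (u : (m.rep K).V j),
      (∀ h : c₀.vertex = j, (cellBasis K m j).repr u ⟨c₀, h⟩ = 0) →
      (p.rep K).x j (π j u) = π (j - 1) ((m.rep K).x j u) := by
    intro j u hu
    refine (cellBasis K p (j - 1)).repr.injective (Finsupp.ext fun d => ?_)
    rw [repr_x, repr_π, repr_x]
    by_cases hd : 0 < d.1.pos
    · obtain ⟨h1, h2⟩ := e_pred d.1 hd
      rw [dif_pos hd, repr_π, dif_pos (show 0 < (f (j - 1) d).1.pos from h1)]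
      exact congrArg _ (Subtype.ext h2.symm)
    · rw [dif_neg hd]
      split_ifs with h1
      · have h2 := e_cut d.1 (by omega) h1
        have h3 : c₀.vertex = j := by
          rw [← h2]
          exact Cell.vertex_pred (f (j - 1) d).2 h1 _
        rw [← hu h3]
        exact congrArg _ (Subtype.ext h2.symm)
      · rfl
  -- the isomorphism: `θ` maps the kernel of `ψ` onto the hyperplane on which the coordinate at `c₀`
  -- vanishes
  let F : ∀ j, LinearMap.ker (headForm ψ j) →ₗ[K] (p.rep K).V j := fun j =>
    (π j ∘ₗ θ.1 j).domRestrict _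
  have F_bij : ∀ j, Function.Bijective (F j) := by
    intro j
    constructor
    · rw [← LinearMap.ker_eq_bot, LinearMap.ker_eq_bot']
      rintro ⟨w, hw⟩ h
      have h1 : π j (θ.1 j w) = 0 := h
      refine Subtype.ext ((θ_bij j).1 ?_)
      refine Eq.trans ?_ (map_zero _).symm
      refine (cellBasis K m j).repr.map_eq_zero_iff.mp (Finsupp.ext fun c => ?_)
      by_cases hc : c.1 = c₀
      · obtain ⟨c, hcj⟩ := c
        simp only at hc
        subst hc
        exact θ_zero j hcj w hw
      · obtain ⟨d, hd⟩ := e_surj c.1 hc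
        have h2 := repr_π j (θ.1 j w) ⟨d, by rw [← e_vertex, hd, c.2]⟩
        rw [h1, map_zero] at h2
        refine Eq.trans (congrArg _ ?_) h2.symm
        exact Subtype.ext hd.symm
    · intro v
      let u := (cellBasis K m j).repr.symm (Finsupp.mapDomain (f j) ((cellBasis K p j).repr v))
      have hu : (cellBasis K m j).repr u =
          Finsupp.mapDomain (f j) ((cellBasis K p j).repr v) := LinearEquiv.apply_symm_apply _ _
      obtain ⟨w, hw⟩ := (θ_bij j).2 u
      refine ⟨⟨w, ?_⟩, ?_⟩
      · rw [LinearMap.mem_ker]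
        by_cases hj : j = i
        · subst hj
          rw [← repr_straighten h₀ hv hmin w, ← hθ, hw, hu]
          refine Finsupp.mapDomain_of_notMem_range _ _ ?_
          rintro ⟨d, hd⟩
          exact e_ne d.1 (Subtype.ext_iff.mp hd)
        · rw [headForm_of_ne ψ hj, LinearMap.zero_apply]
      · change π j (θ.1 j w) = v
        rw [hw]
        refine (cellBasis K p j).repr.injective (Finsupp.ext fun c => ?_)
        rw [repr_π, hu, Finsupp.mapDomain_apply (f_inj j)]
  refine ⟨⟨fun j => LinearEquiv.ofBijective (F j) (F_bij j), fun j => LinearMap.ext fun w => ?_⟩⟩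
  obtain ⟨w, hw⟩ := w
  change (p.rep K).x j (π j (θ.1 j w)) = π (j - 1) (θ.1 (j - 1) ((m.rep K).x j w))
  rw [π_x j _ fun h => θ_zero j h w hw]
  exact congrArg (π (j - 1)) (LinearMap.congr_fun (θ.2 j) w)

end Multisegment

/-! ### Hall polynomials with a simple quotient -/

theorem ZMod.sub_one_ne_self {n : ℕ} (hn : 2 ≤ n) (i : ZMod n) : i - 1 ≠ i := by
  have : Fact (1 < n) := ⟨hn⟩
  simp

theorem CyclicRep.Subrep.ext {K : Type} [Field K] {n : ℕ} {M : CyclicRep K n}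
    {S S' : CyclicRep.Subrep M} (h : ∀ i, S.U i = S'.U i) : S = S' := by
  obtain ⟨U, hU⟩ := S
  obtain ⟨U', hU'⟩ := S'
  obtain rfl : U = U' := funext h
  rfl

/-- Two representations that are isomorphic to the same one are isomorphic. -/
noncomputable def CyclicRep.Iso.symmTrans {K : Type} [Field K] {n : ℕ} {M N P : CyclicRep K n}
    (e : CyclicRep.Iso M N) (e' : CyclicRep.Iso M P) : CyclicRep.Iso N P :=
  ⟨fun j => (e.1 j).symm.trans (e'.1 j), fun j => LinearMap.ext fun w => by
    obtain ⟨w, rfl⟩ := (e.1 j).surjective w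
    have e1 := LinearMap.congr_fun (e.2 j) w
    have e2 := LinearMap.congr_fun (e'.2 j) w
    simp only [LinearMap.comp_apply, LinearEquiv.coe_coe, LinearEquiv.trans_apply,
      LinearEquiv.symm_apply_apply] at e1 e2 ⊢
    rw [e1, e2, LinearEquiv.symm_apply_apply]⟩

theorem LinearMap.exists_smul_eq_of_ker_eq {K V : Type*} [Field K] [AddCommGroup V] [Module K V]
    {φ φ' : V →ₗ[K] K} (hφ : φ ≠ 0) (h : LinearMap.ker φ = LinearMap.ker φ') :
    ∃ a : K, a • φ = φ' := by
  obtain ⟨w, hw⟩ := LinearMap.surjective hφ 1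
  refine ⟨φ' w, LinearMap.ext fun u => ?_⟩
  have h1 : u - φ u • w ∈ LinearMap.ker φ' := by
    rw [← h, LinearMap.mem_ker, map_sub, map_smul, hw, smul_eq_mul, mul_one, sub_self]
  rw [LinearMap.mem_ker, map_sub, map_smul, sub_eq_zero] at h1
  rw [h1, LinearMap.smul_apply, smul_eq_mul, smul_eq_mul, mul_comm]

namespace Multisegment

variable {n : ℕ} {m : Multisegment n} {K : Type} [Field K] {i : ZMod n}

theorem finrank_rep_eq (j : ZMod n) :
    (Module.finrank K ((m.rep K).V j) : ℤ) =
      m.sum fun s a => (a : ℤ) * segDim j (s.1, s.2) := by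
  rw [← dimVec_eq, dimVec, finrank_rep, finrank_rep]

theorem finrank_simple (i j : ZMod n) :
    Module.finrank K ((rep K (Finsupp.single ((1 : ℕ+), i) 1 : Multisegment n)).V j) =
      if i = j then 1 else 0 := by
  zify
  rw [finrank_rep_eq, Finsupp.sum_single_index (by simp)]
  have := segDim_succ j i 0
  rw [segDim_zero, zero_add, zero_add] at this
  rw [Nat.cast_one, one_mul, PNat.val_ofNat, this]

theorem finrank_quotient_headSub {ψ : m.HeadCell i → K} (hψ : ψ ≠ 0) (j : ZMod n) :
    Module.finrank K ((headSub ψ).quotient.V j) = if i = j then 1 else 0 := by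
  refine ((headForm ψ j).quotKerEquivRange.finrank_eq).trans ?_
  split_ifs with h
  · subst h
    rw [LinearMap.range_eq_top.mpr (LinearMap.surjective (headForm_ne_zero hψ)), finrank_top,
      Module.finrank_self]
  · rw [headForm_of_ne ψ (Ne.symm h), LinearMap.range_zero, finrank_bot]

/-- The two representations have the same dimensions, which vanish outside the vertex `i`, and their
maps vanish since there is no loop at `i`. -/
theorem quotient_headSub_iso (hn : 2 ≤ n) {ψ : m.HeadCell i → K} (hψ : ψ ≠ 0) :
    Nonempty (CyclicRep.Iso (headSub ψ).quotient
      (rep K (Finsupp.single ((1 : ℕ+), i) 1 : Multisegment n))) := by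
  have fin : ∀ j, Module.Finite K ((headSub ψ).quotient.V j) := fun j =>
    inferInstanceAs (Module.Finite K ((m.rep K).V j ⧸ LinearMap.ker (headForm ψ j)))
  have e : ∀ j, Nonempty ((headSub ψ).quotient.V j ≃ₗ[K]
      (rep K (Finsupp.single ((1 : ℕ+), i) 1 : Multisegment n)).V j) := fun j =>
    FiniteDimensional.nonempty_linearEquiv_of_finrank_eq
      ((finrank_quotient_headSub hψ j).trans (finrank_simple i j).symm)
  refine ⟨⟨fun j => (e j).some, fun j => LinearMap.ext fun w => ?_⟩⟩
  by_cases h : i = j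
  · have h1 := finrank_simple (K := K) i (j - 1)
    rw [if_neg (by rw [h]; exact (ZMod.sub_one_ne_self hn j).symm)] at h1
    have := Module.finrank_zero_iff.mp h1
    exact Subsingleton.elim _ _
  · have h1 := finrank_quotient_headSub hψ j
    rw [if_neg h] at h1
    have := Module.finrank_zero_iff.mp h1
    rw [Subsingleton.elim w 0, map_zero, map_zero]

/-- A subrepresentation with quotient `K[1; i]` is everything at the vertices `j ≠ i`, and a
hyperplane at `i`, which contains the image of `x`. -/
theorem exists_headSub_eq (hn : 2 ≤ n) (S : CyclicRep.Subrep (m.rep K))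
    (hS : Nonempty (CyclicRep.Iso S.quotient
      (rep K (Finsupp.single ((1 : ℕ+), i) 1 : Multisegment n)))) :
    ∃ ψ : m.HeadCell i → K, ψ ≠ 0 ∧ headSub ψ = S := by
  obtain ⟨e⟩ := hS
  have h1 : ∀ j, Module.finrank K ((m.rep K).V j ⧸ S.U j) = if i = j then 1 else 0 := fun j =>
    ((e.1 j).finrank_eq).trans (finrank_simple i j)
  have h2 : ∀ j, j ≠ i → S.U j = ⊤ := by
    intro j hj
    have h3 := h1 j
    rw [if_neg (Ne.symm hj)] at h3
    have := Module.finrank_zero_iff.mp h3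
    exact Submodule.Quotient.subsingleton_iff.mp this
  have h3 : Module.finrank K ((m.rep K).V i ⧸ S.U i) = Module.finrank K K := by
    rw [h1, if_pos rfl, Module.finrank_self]
  obtain ⟨g⟩ := FiniteDimensional.nonempty_linearEquiv_of_finrank_eq h3
  let φ : (m.rep K).V i →ₗ[K] K := g.toLinearMap ∘ₗ (S.U i).mkQ
  have hφ : LinearMap.ker φ = S.U i := by
    rw [LinearEquiv.ker_comp, Submodule.ker_mkQ]
  let ψ : m.HeadCell i → K := fun c => φ (cellBasis K m i ⟨c.1, c.2.2⟩)
  have h4 : headForm ψ i = φ := by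
    refine (cellBasis K m i).ext fun c => ?_
    rw [headForm_cellBasis]
    split_ifs with h
    · rfl
    · symm
      rw [← LinearMap.mem_ker, hφ]
      clear_value ψ φ
      clear hφ g h3
      obtain ⟨j, rfl⟩ : ∃ j, i = j - 1 := ⟨i + 1, by ring⟩
      obtain ⟨c', hl, -, rfl⟩ :=
        exists_next_eq c (Nat.pos_of_ne_zero fun h' => h ⟨h', c.2⟩)
      have h5 := S.map_mem j (cellBasis K m j c') (by
        rw [h2 j (ZMod.sub_one_ne_self hn j).symm]
        trivial)
      rwa [x_cellBasis, dif_pos hl] at h5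
  refine ⟨ψ, ?_, CyclicRep.Subrep.ext fun j => ?_⟩
  · intro h
    have h5 := h1 i
    rw [if_pos rfl, ← hφ, ← h4, h] at h5
    have h6 := headForm_smul (0 : K) (0 : m.HeadCell i → K) i
    rw [zero_smul, zero_smul] at h6
    rw [h6, LinearMap.ker_zero] at h5
    have : Subsingleton ((m.rep K).V i ⧸ (⊤ : Submodule K ((m.rep K).V i))) :=
      Submodule.Quotient.subsingleton_iff.mpr rfl
    rw [Module.finrank_zero_of_subsingleton] at h5
    exact zero_ne_one h5
  · change LinearMap.ker (headForm ψ j) = S.U j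
    by_cases hj : j = i
    · subst hj
      rw [h4, hφ]
    · rw [headForm_of_ne ψ hj, h2 j hj, LinearMap.ker_zero]

theorem headSub_smul {a : K} (ha : a ≠ 0) (ψ : m.HeadCell i → K) :
    headSub (a • ψ) = headSub ψ := by
  refine CyclicRep.Subrep.ext fun j => ?_
  change LinearMap.ker (headForm (a • ψ) j) = LinearMap.ker (headForm ψ j)
  rw [headForm_smul, LinearMap.ker_smul _ _ ha]

theorem exists_smul_of_headSub_eq {ψ ψ' : m.HeadCell i → K} (hψ : ψ ≠ 0)
    (h : headSub ψ = headSub ψ') : ∃ a : K, a • ψ = ψ' := by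
  have h1 : LinearMap.ker (headForm ψ i) = LinearMap.ker (headForm ψ' i) :=
    congrArg (fun S : CyclicRep.Subrep (m.rep K) => S.U i) h
  obtain ⟨a, ha⟩ := LinearMap.exists_smul_eq_of_ker_eq (headForm_ne_zero hψ) h1
  refine ⟨a, headForm_injective ?_⟩
  exact (headForm_smul a ψ i).trans ha

/-- The subrepresentations with quotient `K[1; i]` are counted by the nonzero functionals on the
head at `i`, up to scalars. -/
theorem hallNumber_mul [Finite K] (hn : 2 ≤ n) (p : Multisegment n) :
    hallNumber (Finsupp.single ((1 : ℕ+), i) 1) p m K * (Nat.card K - 1) =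
      Nat.card {ψ : m.HeadCell i → K //
        ψ ≠ 0 ∧ Nonempty (CyclicRep.Iso (headSub ψ).toRep (p.rep K))} := by
  have hex : ∀ S : {S : CyclicRep.Subrep (m.rep K) //
      Nonempty (CyclicRep.Iso S.toRep (p.rep K)) ∧ Nonempty (CyclicRep.Iso S.quotient
        (rep K (Finsupp.single ((1 : ℕ+), i) 1 : Multisegment n)))},
      ∃ ψ : m.HeadCell i → K, ψ ≠ 0 ∧ headSub ψ = S.1 :=
    fun S => exists_headSub_eq hn S.1 S.2.2
  choose Ψ hΨ hΨS using hex
  let F : _ × Kˣ → {ψ : m.HeadCell i → K //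
      ψ ≠ 0 ∧ Nonempty (CyclicRep.Iso (headSub ψ).toRep (p.rep K))} := fun x =>
    ⟨(x.2 : K) • Ψ x.1, smul_ne_zero x.2.ne_zero (hΨ x.1), by
      rw [headSub_smul x.2.ne_zero, hΨS]
      exact x.1.2.1⟩
  have hF : Function.Bijective F := by
    constructor
    · rintro ⟨S, a⟩ ⟨S', a'⟩ h
      have h1 : (a : K) • Ψ S = (a' : K) • Ψ S' := Subtype.ext_iff.mp h
      have h2 : S = S' := by
        have := congrArg headSub h1
        rw [headSub_smul a.ne_zero, headSub_smul a'.ne_zero, hΨS, hΨS] at this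
        exact Subtype.ext this
      subst h2
      rw [Units.ext (smul_left_injective K (hΨ S) h1)]
    · rintro ⟨ψ, hψ, hp⟩
      let S : {S : CyclicRep.Subrep (m.rep K) //
        Nonempty (CyclicRep.Iso S.toRep (p.rep K)) ∧ Nonempty (CyclicRep.Iso S.quotient
        (rep K (Finsupp.single ((1 : ℕ+), i) 1 : Multisegment n)))} :=
        ⟨headSub ψ, hp, quotient_headSub_iso hn hψ⟩
      obtain ⟨a, ha⟩ := exists_smul_of_headSub_eq (hΨ S) (hΨS S)
      have ha0 : a ≠ 0 := by
        rintro rfl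
        rw [zero_smul] at ha
        exact hψ ha.symm
      exact ⟨(S, Units.mk0 a ha0), Subtype.ext ha⟩
  rw [← Nat.card_congr (Equiv.ofBijective F hF), Nat.card_prod, hallNumber, Nat.card_units]

theorem HeadCell.label_snd (c : m.HeadCell i) : c.1.1.2 = i := by
  rw [← Cell.vertex_head, Cell.head_eq_self c.2.1, c.2.2]

/-- A nonzero functional on the head determines the least length of a segment on whose head it
does not vanish, and thereby the type of its kernel. -/
theorem exists_eq_minus {ψ : m.HeadCell i → K} (hψ : ψ ≠ 0) {p : Multisegment n}
    (hp : Nonempty (CyclicRep.Iso (headSub ψ).toRep (p.rep K))) :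
    ∃ c : m.HeadCell i, ψ c ≠ 0 ∧ (∀ c' : m.HeadCell i, c'.1.len < c.1.len → ψ c' = 0) ∧
      m (c.1.1.1, i) ≠ 0 ∧ p = CyclicHall.minus m c.1.1.1 i := by
  obtain ⟨c₁, hc₁⟩ := Function.ne_iff.mp hψ
  obtain ⟨c, hc, hmin⟩ := Set.exists_min_image {c : m.HeadCell i | ψ c ≠ 0} (fun c => c.1.len)
    (Set.toFinite _) ⟨c₁, hc₁⟩
  have hmin' : ∀ c' : m.HeadCell i, c'.1.len < c.1.len → ψ c' = 0 := by
    intro c' hc'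
    by_contra h
    exact absurd (hmin c' h) (not_le.mpr hc')
  obtain ⟨e⟩ := headSub_iso c.2.1 c.2.2 hc hmin'
  have h2 : m (c.1.1.1, c.1.1.2) ≠ 0 := (lt_of_le_of_lt (Nat.zero_le _) c.1.2.1.2).ne'
  rw [c.label_snd] at e h2
  exact ⟨c, hc, hmin', h2, eq_of_iso (hp.some.symmTrans e)⟩

/-- The types `m⁻_{ℓ,i}` are told apart by the multiplicities of the segments `(ℓ; i]`, since
`i - 1 ≠ i`. -/
theorem minus_injective (hn : 2 ≤ n) {ℓ ℓ' : ℕ+} (h : m (ℓ, i) ≠ 0) (h' : m (ℓ', i) ≠ 0)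
    (e : CyclicHall.minus m ℓ i = CyclicHall.minus m ℓ' i) : ℓ = ℓ' := by
  have h1 := minus_apply h (ℓ, i)
  have hi := ZMod.sub_one_ne_self hn i
  rw [e, minus_apply h'] at h1
  simp only [Prod.mk.injEq, hi, and_false, and_true, if_false, if_true, add_zero] at h1
  by_contra h2
  rw [if_neg (Ne.symm h2)] at h1
  omega

/-- The number of segments `(k; i]` with `k ≥ ℓ`. -/
def headCount (m : Multisegment n) (i : ZMod n) (ℓ : ℕ) : ℕ :=
  m.sum fun s a => if s.2 = i ∧ ℓ ≤ s.1 then a else 0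

theorem headCount_eq (ℓ : ℕ+) :
    m.headCount i ℓ = m.headCount i (ℓ + 1) + m (ℓ, i) := by
  have h : ∀ s : ℕ+ × ZMod n, (if s.2 = i ∧ (ℓ : ℕ) ≤ s.1 then m s else 0) =
      (if s.2 = i ∧ (ℓ : ℕ) + 1 ≤ s.1 then m s else 0) + if s = (ℓ, i) then m s else 0 := by
    rintro ⟨k, j⟩
    by_cases hj : j = i
    · simp only [hj, true_and, Prod.mk.injEq, and_true, ← PNat.coe_inj]
      split_ifs <;> omega
    · simp [hj]
  simp only [headCount, Finsupp.sum, h, Finset.sum_add_distrib]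
  congr 1
  rw [Finset.sum_ite_eq']
  split_ifs with h1
  · rfl
  · exact (Finsupp.notMem_support_iff.mp h1).symm

theorem card_headCell (ℓ : ℕ) :
    Nat.card {c : m.HeadCell i // ℓ ≤ c.1.len} = m.headCount i ℓ := by
  have h := sum_head (m := m) fun s => if s.2 = i ∧ ℓ ≤ s.1 then 1 else 0
  simp only [mul_ite, mul_one, mul_zero] at h
  rw [← Nat.cast_inj (R := ℤ), Nat.card_congr (Equiv.subtypeSubtypeEquivSubtypeInter
    (fun c : m.Cell => c.pos = 0 ∧ c.vertex = i) fun c => ℓ ≤ c.len), Nat.card_eq_fintype_card,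
    Fintype.card_subtype, Finset.card_filter, headCount, Finsupp.sum]
  push_cast
  refine Eq.trans ?_ h
  refine Finset.sum_congr rfl fun c _ => ?_
  by_cases hc : c.pos = 0
  · rw [← Cell.vertex_head, Cell.head_eq_self hc]
    simp [hc]
  · simp [hc]

/-- The number of functionals on the head that vanish on the segments of length less than `ℓ`. -/
theorem card_vanishing [Finite K] (ℓ : ℕ) :
    Nat.card {ψ : m.HeadCell i → K // ∀ c, c.1.len < ℓ → ψ c = 0} =
      Nat.card K ^ m.headCount i ℓ := by
  have h := card_fun_comp (K := K)
    (Subtype.val_injective : Function.Injective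
      (Subtype.val : {c : m.HeadCell i // ¬ ℓ ≤ c.1.len} → m.HeadCell i)) fun β => β = 0
  rw [@Nat.card_unique {β : {c : m.HeadCell i // ¬ ℓ ≤ c.1.len} → K // β = 0}, one_mul] at h
  have h1 : Nat.card (m.HeadCell i) - Nat.card {c : m.HeadCell i // ¬ ℓ ≤ c.1.len} =
      m.headCount i ℓ := by
    have : Fintype (m.HeadCell i) := Fintype.ofFinite _
    rw [← card_headCell, Nat.card_eq_fintype_card, Nat.card_eq_fintype_card,
      Nat.card_eq_fintype_card, Fintype.card_subtype_compl]
    exact Nat.sub_sub_self (Fintype.card_subtype_le _)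
  rw [← h1, ← h]
  refine Nat.card_congr (Equiv.subtypeEquivRight fun ψ => ?_)
  constructor
  · intro hψ
    exact funext fun c => hψ c.1 (not_le.mp c.2)
  · intro hψ c hc
    exact congrFun hψ ⟨c, not_le.mpr hc⟩

/-- The Hall polynomial `F^m_{(1;i],p}` for `p = m⁻_{ℓ,i}`. -/
noncomputable def simpleHallPoly (m : Multisegment n) (ℓ : ℕ+) (i : ZMod n) : ℤ[X] :=
  X ^ m.headCount i (ℓ + 1) * ∑ k ∈ Finset.range (m (ℓ, i)), X ^ k

theorem hallPolynomial_minus (hn : 2 ≤ n) {ℓ : ℕ+} (h : m (ℓ, i) ≠ 0) :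
    hallPolynomial (Finsupp.single ((1 : ℕ+), i) 1) (CyclicHall.minus m ℓ i) m =
      m.simpleHallPoly ℓ i := by
  refine IsCountingPolynomial.countingPolynomial_eq fun K _ _ => ?_
  have h1 := hallNumber_mul (m := m) (K := K) (i := i) hn (CyclicHall.minus m ℓ i)
  -- type `m⁻_{ℓ,i}` means that `ψ` vanishes on the segments shorter than `ℓ`, but not on all those of
  -- length `ℓ`
  have h2 : Nat.card {ψ : m.HeadCell i → K // ψ ≠ 0 ∧ Nonempty (CyclicRep.Iso (headSub ψ).toRep
        ((CyclicHall.minus m ℓ i).rep K))} +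
      Nat.card {ψ : m.HeadCell i → K // ∀ c, c.1.len < (ℓ : ℕ) + 1 → ψ c = 0} =
      Nat.card {ψ : m.HeadCell i → K // ∀ c, c.1.len < (ℓ : ℕ) → ψ c = 0} := by
    have hd : Disjoint {ψ : m.HeadCell i → K | ψ ≠ 0 ∧
        Nonempty (CyclicRep.Iso (headSub ψ).toRep ((CyclicHall.minus m ℓ i).rep K))}
        {ψ | ∀ c, c.1.len < (ℓ : ℕ) + 1 → ψ c = 0} := by
      rw [Set.disjoint_left]
      rintro ψ ⟨hψ, e⟩ hψ'
      obtain ⟨c, hc, -, hm, e⟩ := exists_eq_minus hψ e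
      have hℓ := minus_injective hn h hm e
      refine hc (hψ' c ?_)
      rw [hℓ]
      exact Nat.lt_succ_self _
    have hu : {ψ : m.HeadCell i → K | ψ ≠ 0 ∧
        Nonempty (CyclicRep.Iso (headSub ψ).toRep ((CyclicHall.minus m ℓ i).rep K))} ∪
        {ψ | ∀ c, c.1.len < (ℓ : ℕ) + 1 → ψ c = 0} =
        {ψ | ∀ c, c.1.len < (ℓ : ℕ) → ψ c = 0} := by
      ext ψ
      constructor
      · rintro (⟨hψ, e⟩ | hψ)
        · obtain ⟨c, -, hmin, hm, e⟩ := exists_eq_minus hψ e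
          have hℓ := minus_injective hn h hm e
          rw [hℓ]
          exact hmin
        · exact fun c hc => hψ c (by omega)
      · intro hψ
        by_cases h3 : ∀ c, c.1.len < (ℓ : ℕ) + 1 → ψ c = 0
        · exact Or.inr h3
        · push Not at h3
          obtain ⟨c, hc, hc'⟩ := h3
          have hlen : c.1.len = ℓ := by
            by_contra hne
            exact hc' (hψ c (by omega))
          have h4 := headSub_iso c.2.1 c.2.2 hc' fun c' hc' => hψ c' (by omega)
          rw [c.label_snd, PNat.eq hlen] at h4
          refine Or.inl ⟨?_, h4⟩
          rintro rfl
          exact hc' rfl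
    have := Set.ncard_union_eq hd
    rw [hu] at this
    exact this.symm
  rw [← h1, card_vanishing, card_vanishing, headCount_eq] at h2
  have hq : 1 < Nat.card K := Finite.one_lt_card
  have h3 := geom_sum_mul (Nat.card K : ℤ) (m (ℓ, i))
  zify [hq.le] at h2
  have hq' : (Nat.card K : ℤ) - 1 ≠ 0 := by omega
  refine mul_right_cancel₀ hq' ?_
  rw [simpleHallPoly, eval_mul, eval_pow, eval_X, eval_finsetSum]
  simp only [eval_pow, eval_X]
  rw [mul_assoc, h3]
  linear_combination -h2

theorem hallPolynomial_eq_zero (hn : 2 ≤ n) {p : Multisegment n}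
    (h : ∀ ℓ, m (ℓ, i) ≠ 0 → p ≠ CyclicHall.minus m ℓ i) :
    hallPolynomial (Finsupp.single ((1 : ℕ+), i) 1) p m = 0 := by
  refine IsCountingPolynomial.countingPolynomial_eq fun K _ _ => ?_
  rw [eval_zero, eq_comm, Nat.cast_eq_zero]
  have h1 := hallNumber_mul (m := m) (K := K) (i := i) hn p
  have hq : 1 < Nat.card K := Finite.one_lt_card
  have h2 : IsEmpty {ψ : m.HeadCell i → K //
      ψ ≠ 0 ∧ Nonempty (CyclicRep.Iso (headSub ψ).toRep (p.rep K))} := by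
    refine ⟨fun ⟨ψ, hψ, e⟩ => ?_⟩
    obtain ⟨c, -, -, hm, e⟩ := exists_eq_minus hψ e
    exact h _ hm e
  rw [@Nat.card_of_isEmpty _ h2] at h1
  exact (Nat.mul_eq_zero.mp h1).resolve_right (by omega)

end Multisegment

/-! ### Numerical invariants of `m⁻_{ℓ,i}` -/

namespace Multisegment

variable {n : ℕ} {m : Multisegment n} {i : ZMod n}

/-- How an additive function of the segments changes from `m` to `m⁻_{ℓ,i}`. -/
theorem sum_minus {ℓ : ℕ+} (h : m (ℓ, i) ≠ 0) (G : ℕ × ZMod n → ℤ) (hG : ∀ j, G (0, j) = 0) :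
    ((CyclicHall.minus m ℓ i).sum fun s a => (a : ℤ) * G (s.1, s.2)) =
      (m.sum fun s a => (a : ℤ) * G (s.1, s.2)) - G (ℓ, i) + G ((ℓ : ℕ) - 1, i - 1) := by
  have hle : Finsupp.single (ℓ, i) 1 ≤ m := by
    rw [Finsupp.single_le_iff]
    exact Nat.one_le_iff_ne_zero.mpr h
  have hadd : ∀ x y : Multisegment n, ((x + y).sum fun s a => (a : ℤ) * G (s.1, s.2)) =
      (x.sum fun s a => (a : ℤ) * G (s.1, s.2)) + y.sum fun s a => (a : ℤ) * G (s.1, s.2) :=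
    fun x y => Finsupp.sum_add_index' (fun _ => by simp) fun _ a b => by push_cast; ring
  have hsingle : ∀ s : ℕ+ × ZMod n, ((Finsupp.single s 1 : Multisegment n).sum fun s a =>
      (a : ℤ) * G (s.1, s.2)) = G (s.1, s.2) := fun s => by
    rw [Finsupp.sum_single_index (by simp), Nat.cast_one, one_mul]
  have h1 := hadd (m - Finsupp.single (ℓ, i) 1) (Finsupp.single (ℓ, i) 1)
  rw [tsub_add_cancel_of_le hle, hsingle] at h1
  by_cases hℓ : ℓ = 1
  · subst hℓ
    rw [CyclicHall.minus, if_pos rfl, h1, PNat.val_ofNat, Nat.sub_self, hG]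
    ring
  · rw [CyclicHall.minus, if_neg hℓ, hadd, hsingle, h1, coe_pred hℓ]
    ring

theorem dimVec_minus {ℓ : ℕ+} (h : m (ℓ, i) ≠ 0) (j : ZMod n) :
    m.dimVec j = (CyclicHall.minus m ℓ i).dimVec j + if i = j then 1 else 0 := by
  zify
  rw [dimVec_eq, dimVec_eq, sum_minus h _ fun j' => segDim_zero j j']
  have h1 := segDim_succ j i ((ℓ : ℕ) - 1)
  rw [Nat.sub_add_cancel ℓ.pos] at h1
  linarith

theorem totalDim_minus [NeZero n] {ℓ : ℕ+} (h : m (ℓ, i) ≠ 0) :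
    m.totalDim = (CyclicHall.minus m ℓ i).totalDim + 1 := by
  simp only [totalDim, dimVec_minus h, Finset.sum_add_distrib, Finset.sum_ite_eq,
    Finset.mem_univ, if_true]

theorem headCount_eq_sum (ℓ : ℕ) : (m.headCount i ℓ : ℤ) =
    m.sum fun s a => (a : ℤ) * if s.2 = i ∧ ℓ ≤ s.1 then 1 else 0 := by
  simp only [headCount, Finsupp.sum, mul_ite, mul_one, mul_zero]
  push_cast
  rfl

theorem endDim_minus (hn : 2 ≤ n) {ℓ : ℕ+} (h : m (ℓ, i) ≠ 0) :
    (m.endDim : ℤ) = (CyclicHall.minus m ℓ i).endDim + m.headCount i ℓ - 1 + m.dimVec i -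
      m.dimVec (i - 1) + m.headCount (i - 1) ℓ := by
  have hℓ := Nat.sub_add_cancel ℓ.pos
  let L : ℕ × ZMod n → ℤ := fun s => m.sum fun t b => (b : ℤ) * segHom s (t.1, t.2)
  have hright : ∀ s : ℕ × ZMod n,
      ((CyclicHall.minus m ℓ i).sum fun t b => (b : ℤ) * segHom s (t.1, t.2)) =
      L s - if i = s.2 ∧ (ℓ : ℕ) ≤ s.1 then 1 else 0 := by
    intro s
    rw [sum_minus h (segHom s) fun j => segHom_zero_right j s]
    have h1 := segHom_succ_right s i ((ℓ : ℕ) - 1)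
    rw [hℓ] at h1
    linarith
  have hleft : L (ℓ, i) - L ((ℓ : ℕ) - 1, i - 1) =
      m.dimVec i - m.dimVec (i - 1) + m.headCount (i - 1) ℓ := by
    rw [dimVec_eq, dimVec_eq, headCount_eq_sum]
    simp only [L, Finsupp.sum, ← Finset.sum_sub_distrib, ← Finset.sum_add_distrib, ← mul_sub,
      ← mul_add]
    refine Finset.sum_congr rfl fun t _ => congrArg _ ?_
    have h1 := segHom_succ_left (t.1, t.2) i ((ℓ : ℕ) - 1)
    rw [hℓ] at h1
    linarith
  have houter := sum_minus h (fun s => L s - if i = s.2 ∧ (ℓ : ℕ) ≤ s.1 then 1 else 0) fun j => by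
    rw [if_neg (by simp), sub_zero]
    exact Finset.sum_eq_zero fun t _ => mul_eq_zero_of_right _ (segHom_zero_left j _)
  rw [endDim_eq, endDim_eq]
  simp only [hright, houter]
  have hi : i ≠ i - 1 := (ZMod.sub_one_ne_self hn i).symm
  simp only [hi, false_and, if_false, le_refl, and_self, if_true]
  have hm : (m.sum fun s a => (a : ℤ) *
      (L (s.1, s.2) - if i = s.2 ∧ (ℓ : ℕ) ≤ s.1 then 1 else 0)) =
      (m.sum fun s a => (a : ℤ) * L (s.1, s.2)) - m.headCount i ℓ := by
    rw [headCount_eq_sum]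
    simp only [Finsupp.sum, mul_sub, Finset.sum_sub_distrib, eq_comm (a := i)]
  rw [hm]
  change (m.sum fun s a => (a : ℤ) * L (s.1, s.2)) = _
  linarith

theorem orbitDim_minus [NeZero n] (hn : 2 ≤ n) {ℓ : ℕ+} (h : m (ℓ, i) ≠ 0) :
    ((CyclicHall.minus m ℓ i).orbitDim : ℤ) - m.orbitDim +
      ((CyclicHall.minus m ℓ i).dimVec (i - 1) + (CyclicHall.minus m ℓ i).dimVec i) =
      m.headCount i ℓ + m.headCount (i - 1) ℓ - 1 := by
  have h1 := congrArg (Nat.cast : ℕ → ℤ) (m.orbitDim_add_endDim)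
  have h2 := congrArg (Nat.cast : ℕ → ℤ) ((CyclicHall.minus m ℓ i).orbitDim_add_endDim)
  have h3 := endDim_minus hn h
  have h4 : ∀ j, (m.dimVec j : ℤ) ^ 2 = (CyclicHall.minus m ℓ i).dimVec j ^ 2 +
      if i = j then 2 * ((CyclicHall.minus m ℓ i).dimVec j : ℤ) + 1 else 0 := by
    intro j
    rw [dimVec_minus h]
    split_ifs
    · push_cast
      ring
    · simp
  push_cast at h1 h2
  simp only [h4, Finset.sum_add_distrib, Finset.sum_ite_eq, Finset.mem_univ, if_true] at h1
  rw [dimVec_minus h, dimVec_minus h, if_pos rfl,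
    if_neg (ZMod.sub_one_ne_self hn i).symm] at h3
  push_cast at h3
  linarith

theorem headCount_eq_finsum (ℓ : ℕ+) :
    (m.headCount i ℓ : ℤ) = ∑ᶠ k ∈ Set.Ici ℓ, (m (k, i) : ℤ) := by
  have h1 := finsum_mem_image (f := fun s => (m s : ℤ)) (s := Set.Ici ℓ)
    (g := fun k : ℕ+ => (k, i)) fun a _ b _ hab => congrArg Prod.fst hab
  rw [← h1, headCount, Finsupp.sum, finsum_mem_eq_sum_of_inter_support_eq
    (t := m.support.filter fun s => s.2 = i ∧ (ℓ : ℕ) ≤ s.1), Finset.sum_filter]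
  · push_cast
    rfl
  · ext ⟨k, j⟩
    simp only [Set.mem_inter_iff, Set.mem_image, Set.mem_Ici, Prod.mk.injEq,
      Function.mem_support, Finset.coe_filter, Finsupp.mem_support_iff, Set.mem_ofPred_eq, ne_eq,
      Nat.cast_eq_zero, PNat.coe_le_coe]
    constructor
    · rintro ⟨⟨k', hk, rfl, rfl⟩, h⟩
      exact ⟨⟨h, rfl, hk⟩, h⟩
    · rintro ⟨⟨-, rfl, hk⟩, h⟩
      exact ⟨⟨k, hk, rfl, rfl⟩, h⟩

theorem finite_support_fst (i : ZMod n) : {k : ℕ+ | m (k, i) ≠ 0}.Finite := by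
  refine (m.support.image Prod.fst).finite_toSet.subset fun k hk => ?_
  rw [Finset.coe_image]
  exact ⟨(k, i), Finsupp.mem_support_iff.mpr hk, rfl⟩

theorem expo_eq (ℓ : ℕ+) :
    CyclicHall.expo m ℓ i = m.headCount (i - 1) ℓ - m.headCount i (ℓ + 1) := by
  have h2 : (m.headCount i (ℓ + 1) : ℤ) = ∑ᶠ k ∈ Set.Ioi ℓ, (m (k, i) : ℤ) := by
    have := headCount_eq_finsum (m := m) (i := i) (ℓ + 1)
    rw [PNat.add_coe, PNat.val_ofNat] at this
    rw [this]
    refine finsum_mem_congr (Set.ext fun k => ?_) fun _ _ => rfl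
    exact PNat.add_one_le_iff
  have h1 : (m.headCount (i - 1) ℓ : ℤ) = ∑ᶠ k ∈ Set.Ioi ℓ, (m (k - 1, i - 1) : ℤ) := by
    have h3 := finsum_mem_image (f := fun k : ℕ+ => (m (k - 1, i - 1) : ℤ)) (s := Set.Ici ℓ)
      (g := fun k : ℕ+ => k + 1) fun a _ b _ hab => add_right_cancel hab
    have h4 : ∀ k : ℕ+, k + 1 - 1 = k := fun k => PNat.add_sub
    simp only [h4] at h3
    rw [headCount_eq_finsum, ← h3]
    refine finsum_mem_congr (Set.ext fun k => ?_) fun _ _ => rfl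
    constructor
    · rintro ⟨k, hk, rfl⟩
      exact PNat.lt_add_one_iff.mpr hk
    · intro hk
      refine ⟨k - 1, ?_, ?_⟩
      · refine PNat.lt_add_one_iff.mp ?_
        rw [PNat.sub_add_of_lt (lt_of_le_of_lt one_le hk)]
        exact hk
      · exact PNat.sub_add_of_lt (lt_of_le_of_lt one_le hk)
  have h3 : (Function.support fun k : ℕ+ => (m (k - 1, i - 1) : ℤ)) ∩ Set.Ioi ℓ ⊆
      (fun k : ℕ+ => k + 1) '' {k | m (k, i - 1) ≠ 0} := by
    rintro k ⟨hk, hk'⟩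
    refine ⟨k - 1, ?_, PNat.sub_add_of_lt (lt_of_le_of_lt one_le hk')⟩
    exact fun h => hk (congrArg _ h)
  have h4 : (Function.support fun k : ℕ+ => (m (k, i) : ℤ)) ⊆ {k | m (k, i) ≠ 0} :=
    fun k hk h => hk (congrArg _ h)
  rw [h1, h2, finsum_mem_def, finsum_mem_def, ← finsum_sub_distrib]
  · rw [CyclicHall.expo]
    refine finsum_congr fun k => ?_
    rw [finsum_eq_if, Set.indicator_apply, Set.indicator_apply]
    by_cases hk : ℓ < k
    · rw [if_pos hk, if_pos (Set.mem_Ioi.mpr hk), if_pos (Set.mem_Ioi.mpr hk)]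
    · rw [if_neg hk, if_neg (mt Set.mem_Ioi.mp hk), if_neg (mt Set.mem_Ioi.mp hk), sub_zero]
  · refine (((finite_support_fst (m := m) (i - 1)).image _).subset h3).subset ?_
    rw [Set.support_indicator, Set.inter_comm]
  · refine ((finite_support_fst (m := m) i).subset h4).subset ?_
    rw [Set.support_indicator]
    exact Set.inter_subset_right

end Multisegment

/-! ### The scalar product and the adjoint of `f_i` -/

namespace CyclicHall

open Multisegment

variable {n : ℕ} {m : Multisegment n} {i : ZMod n}

theorem one_sub_v_pow_ne_zero {k : ℕ} (hk : k ≠ 0) : 1 - v ^ k ≠ 0 := by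
  intro h
  have h1 : algebraMap ℂ[X] Cv (X ^ k) = algebraMap ℂ[X] Cv 1 := by
    rw [map_pow, RatFunc.algebraMap_X, map_one]
    exact (sub_eq_zero.mp h).symm
  have h2 := congrArg natDegree (RatFunc.algebraMap_injective ℂ h1)
  rw [natDegree_X_pow, natDegree_one] at h2
  exact hk h2

/-- `(1 - v²)(1 - v⁴)⋯(1 - v²ᵃ)`. -/
noncomputable def phi (a : ℕ) : Cv := ∏ k ∈ Finset.range a, (1 - v ^ (2 * (k + 1)))

theorem phi_ne_zero (a : ℕ) : phi a ≠ 0 :=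
  Finset.prod_ne_zero_iff.mpr fun _ _ => one_sub_v_pow_ne_zero (by omega)

theorem phi_succ (a : ℕ) : phi (a + 1) = phi a * (1 - v ^ (2 * (a + 1))) :=
  Finset.prod_range_succ _ _

/-- The product of `phi` over the multiplicities. -/
noncomputable def phiProd (m : Multisegment n) : Cv := m.prod fun _ a => phi a

theorem phiProd_ne_zero (m : Multisegment n) : phiProd m ≠ 0 :=
  Finset.prod_ne_zero_iff.mpr fun _ _ => phi_ne_zero _

/-- The order of `GL_a` at `q = v⁻²`. -/
theorem prod_v_pow_sub (a : ℕ) :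
    ∏ k : Fin a, ((v ^ (-2 : ℤ)) ^ a - (v ^ (-2 : ℤ)) ^ (k : ℕ)) =
      (v ^ (-2 : ℤ)) ^ (a * a) * phi a := by
  have hv := v_ne_zero
  have h : ∀ k ∈ Finset.range a, (v ^ (-2 : ℤ)) ^ a - (v ^ (-2 : ℤ)) ^ k =
      (v ^ (-2 : ℤ)) ^ a * (1 - v ^ (2 * (a - 1 - k + 1))) := by
    intro k hk
    rw [Finset.mem_range] at hk
    obtain ⟨b, rfl⟩ := Nat.exists_eq_add_of_lt hk
    rw [show k + b + 1 - 1 - k + 1 = b + 1 by omega, mul_sub, mul_one]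
    congr 1
    rw [← zpow_natCast, ← zpow_natCast, ← zpow_natCast, ← zpow_mul, ← zpow_mul, ← zpow_add₀ hv]
    congr 1
    push_cast
    ring
  rw [Fin.prod_univ_eq_prod_range (fun k => (v ^ (-2 : ℤ)) ^ a - (v ^ (-2 : ℤ)) ^ k),
    Finset.prod_congr rfl h, Finset.prod_mul_distrib, Finset.prod_const, Finset.card_range,
    ← pow_mul, phi, Finset.prod_range_reflect (fun k => 1 - v ^ (2 * (k + 1)))]

theorem aeval_autPolynomial (m : Multisegment n) :
    aeval (v ^ (-2 : ℤ)) m.autPolynomial = v ^ (-2 * (m.endDim : ℤ)) * phiProd m := by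
  rw [autPolynomial_eq, autPoly]
  simp only [map_mul, map_prod, map_sub, map_pow, aeval_X, prod_v_pow_sub,
    Finset.prod_mul_distrib, Finset.prod_pow_eq_pow_sum]
  rw [mul_right_comm, zpow_mul, zpow_natCast, ← Nat.add_sub_cancel' m.sumSq_le_endDim, pow_add,
    Nat.add_sub_cancel' m.sumSq_le_endDim]
  rfl

/-- The value `(⟨m⟩, ⟨m⟩)`, in which the power of `v` in the scalar product has cancelled against the
leading power in `|Aut 𝔽_q[m]|`. -/
noncomputable def normSq [NeZero n] (m : Multisegment n) : Cv :=
  (1 - v ^ 2) ^ m.totalDim / phiProd m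

theorem normSq_ne_zero [NeZero n] (m : Multisegment n) : normSq m ≠ 0 :=
  div_ne_zero (pow_ne_zero _ (one_sub_v_pow_ne_zero two_ne_zero)) (phiProd_ne_zero m)

theorem scalarProduct_pbw [NeZero n] (m : Multisegment n) (y : HallSpace n) :
    scalarProduct n (pbw n m) y = normSq m * (pbw n).coord m y := by
  have h : v ^ (-2 * (m.endDim : ℤ)) ≠ 0 := zpow_ne_zero _ v_ne_zero
  rw [scalarProduct, Module.Basis.constr_basis, LinearMap.smul_apply, smul_eq_mul,
    aeval_autPolynomial, normSq]
  congr 1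
  field_simp

theorem scalarProduct_pbw_right [NeZero n] (x : HallSpace n) (p : Multisegment n) :
    scalarProduct n x (pbw n p) = normSq p * (pbw n).coord p x := by
  have h : LinearMap.flip (scalarProduct n) (pbw n p) = normSq p • (pbw n).coord p := by
    refine (pbw n).ext fun m => ?_
    rw [LinearMap.flip_apply, scalarProduct_pbw, LinearMap.smul_apply, smul_eq_mul,
      Module.Basis.coord_apply, Module.Basis.coord_apply, Module.Basis.repr_self,
      Module.Basis.repr_self, Finsupp.single_apply, Finsupp.single_apply]
    by_cases hpm : p = m
    · rw [hpm]
    · rw [if_neg hpm, if_neg (Ne.symm hpm), mul_zero, mul_zero]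
  exact LinearMap.congr_fun h x

/-- The factor `1 - v^{2(m_{(ℓ-1;i-1]}+1)}`, which is absent for `ℓ = 1`. -/
noncomputable def growth (m : Multisegment n) (ℓ : ℕ+) (i : ZMod n) : Cv :=
  if ℓ = 1 then 1 else 1 - v ^ (2 * (m (ℓ - 1, i - 1) + 1))

theorem phiProd_eq (m : Multisegment n) (s : ℕ+ × ZMod n) :
    phiProd m = phi (m s) * phiProd (m.erase s) :=
  (Finsupp.mul_prod_erase' m s (fun _ a => phi a) fun _ => Finset.prod_range_zero _).symm

/-- Only the multiplicities of `(ℓ; i]` and `(ℓ - 1; i - 1]` change. -/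
theorem phiProd_minus (hn : 2 ≤ n) {ℓ : ℕ+} (h : m (ℓ, i) ≠ 0) :
    phiProd m * growth m ℓ i =
      phiProd (minus m ℓ i) * (1 - v ^ (2 * m (ℓ, i))) := by
  have hi := ZMod.sub_one_ne_self hn i
  have h1 := minus_apply h (ℓ, i)
  simp only [Prod.mk.injEq, hi, and_false, if_false, if_true, add_zero] at h1
  obtain ⟨a, ha⟩ := Nat.exists_eq_succ_of_ne_zero h
  have h2 : minus m ℓ i (ℓ, i) = a := by
    rw [ha] at h1
    push_cast at h1
    omega
  rw [phiProd_eq m (ℓ, i), phiProd_eq (minus m ℓ i) (ℓ, i), h2, ha, Nat.succ_eq_add_one, phi_succ]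
  by_cases hℓ : ℓ = 1
  · subst hℓ
    have h3 : (minus m 1 i).erase (1, i) = m.erase (1, i) := by
      ext s
      rw [Finsupp.erase_apply, Finsupp.erase_apply]
      split_ifs with hs
      · rfl
      · have h4 := minus_apply h s
        have h5 : ¬ (((1 : ℕ+) : ℕ) - 1, i - 1) = ((s.1 : ℕ), s.2) := fun h6 => by
          have := s.1.pos
          have h7 := congrArg Prod.fst h6
          simp only [PNat.val_ofNat] at h7
          omega
        rw [if_neg (Ne.symm hs), if_neg h5] at h4
        omega
    rw [h3, growth, if_pos rfl]
    ring
  · have hne : ((ℓ - 1, i - 1) : ℕ+ × ZMod n) ≠ (ℓ, i) := fun h3 => hi (congrArg Prod.snd h3)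
    have h3 := minus_apply h (ℓ - 1, i - 1)
    rw [if_neg (Ne.symm hne), coe_pred hℓ, if_pos rfl] at h3
    have h4 : minus m ℓ i (ℓ - 1, i - 1) = m (ℓ - 1, i - 1) + 1 := by omega
    have h5 : ((minus m ℓ i).erase (ℓ, i)).erase (ℓ - 1, i - 1) =
        (m.erase (ℓ, i)).erase (ℓ - 1, i - 1) := by
      ext s
      simp only [Finsupp.erase_apply]
      split_ifs with hs hs'
      · rfl
      · rfl
      · have h6 := minus_apply h s
        have h7 : ¬ ((ℓ : ℕ) - 1, i - 1) = ((s.1 : ℕ), s.2) := fun h8 => hs (by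
          rw [← coe_pred hℓ] at h8
          exact Prod.ext (PNat.eq (congrArg Prod.fst h8).symm) (congrArg Prod.snd h8).symm)
        rw [if_neg (Ne.symm hs'), if_neg h7] at h6
        omega
    rw [phiProd_eq (m.erase (ℓ, i)) (ℓ - 1, i - 1),
      phiProd_eq ((minus m ℓ i).erase (ℓ, i)) (ℓ - 1, i - 1), h5, Finsupp.erase_ne hne,
      Finsupp.erase_ne hne, h4, phi_succ, growth, if_neg hℓ]
    ring

theorem dimVec_simple (j : ZMod n) :
    Multisegment.dimVec (n := n) (Finsupp.single (1, i) 1) j = if i = j then 1 else 0 :=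
  finrank_simple i j

theorem orbitDim_simple [NeZero n] :
    Multisegment.orbitDim (n := n) (Finsupp.single (1, i) 1) = 0 := by
  have h1 := orbitDim_add_endDim (m := (Finsupp.single (1, i) 1 : Multisegment n))
  have h2 : (Multisegment.endDim (n := n) (Finsupp.single (1, i) 1) : ℤ) = 1 := by
    rw [endDim_eq, Finsupp.sum_single_index (by simp), Finsupp.sum_single_index (by simp)]
    simp [segHom, Finset.filter_singleton]
  simp only [dimVec_simple, ite_pow, one_pow, ne_eq, OfNat.ofNat_ne_zero, not_false_eq_true,
    zero_pow, Finset.sum_ite_eq, Finset.mem_univ, if_true] at h1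
  omega

theorem twistForm_simple [NeZero n] (b : ZMod n → ℕ) :
    twistForm (Multisegment.dimVec (n := n) (Finsupp.single (1, i) 1)) b = b (i - 1) + b i := by
  simp only [twistForm, dimVec_simple, ite_mul, one_mul, zero_mul, Finset.sum_ite_eq,
    Finset.mem_univ, if_true]

/-- Only finitely many multisegments are obtained from `p` by adding a head at `i` to a segment or
a new segment `(1; i]`. -/
theorem finite_minus_eq (p : Multisegment n) (i : ZMod n) :
    {q : Multisegment n | ∃ ℓ, q (ℓ, i) ≠ 0 ∧ p = minus q ℓ i}.Finite := by
  have hT := (finite_support_fst (m := p) (i - 1)).image fun k : ℕ+ => k + 1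
  refine (((Set.finite_singleton (1 : ℕ+)).union hT).image fun ℓ : ℕ+ =>
    if ℓ = 1 then p + Finsupp.single (1, i) 1
    else p - Finsupp.single (ℓ - 1, i - 1) 1 + Finsupp.single (ℓ, i) 1).subset ?_
  rintro q ⟨ℓ, hq, rfl⟩
  have hle : Finsupp.single (ℓ, i) 1 ≤ q := by
    rw [Finsupp.single_le_iff]
    exact Nat.one_le_iff_ne_zero.mpr hq
  refine ⟨ℓ, ?_, ?_⟩
  · by_cases hℓ : ℓ = 1
    · exact Or.inl hℓ
    · refine Or.inr ⟨ℓ - 1, ?_, PNat.sub_add_of_lt (lt_of_le_of_ne one_le (Ne.symm hℓ))⟩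
      simp [minus, hℓ]
  · by_cases hℓ : ℓ = 1
    · subst hℓ
      simp only [minus, if_true]
      exact tsub_add_cancel_of_le hle
    · simp only [minus, if_neg hℓ, add_tsub_cancel_right]
      exact tsub_add_cancel_of_le hle

/-- The coefficient of `⟨m⟩` in `f_i ⟨p⟩`. -/
theorem coord_chevalleyF [NeZero n] (hn : 2 ≤ n) (m p : Multisegment n) :
    (pbw n).coord m (chevalleyF i (pbw n p)) =
      v ^ ((p.orbitDim : ℤ) - m.orbitDim + (p.dimVec (i - 1) + p.dimVec i)) *
        aeval (v ^ (-2 : ℤ)) (hallPolynomial (Finsupp.single (1, i) 1) p m) := by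
  have hv := v_ne_zero
  have hpbw : ∀ p : Multisegment n, pbw n p = v ^ p.orbitDim • u n p := fun p => by
    rw [pbw, Module.Basis.unitsSMul_apply, Units.smul_def]
    simp
  have hcoord : ∀ q, (pbw n).coord m (u n q) =
      if q = m then (v ^ m.orbitDim)⁻¹ else 0 := fun q => by
    rw [pbw, Module.Basis.coord_unitsSMul, LinearMap.smul_apply, Module.Basis.coord_apply,
      Module.Basis.repr_self, Finsupp.single_apply, Units.smul_def]
    split_ifs
    · simp
    · simp
  have hfin : (Function.support fun q : Multisegment n => (aeval (v ^ (-2 : ℤ))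
      (hallPolynomial (Finsupp.single (1, i) 1) p q)) • u n q).Finite := by
    refine (finite_minus_eq p i).subset fun q hq => ?_
    by_contra h
    refine hq ?_
    have h1 : ∀ ℓ, q (ℓ, i) ≠ 0 → p ≠ minus q ℓ i := fun ℓ h2 h3 => h ⟨ℓ, h2, h3⟩
    simp only [hallPolynomial_eq_zero hn h1, map_zero, zero_smul]
  rw [chevalleyF, hpbw (Finsupp.single _ _), orbitDim_simple, pow_zero, one_smul, hpbw p, map_smul,
    hallMul, Module.Basis.constr_basis, Module.Basis.constr_basis, map_smul, map_smul,
    map_finsum _ hfin, finsum_eq_single _ m]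
  · rw [map_smul, hcoord, if_pos rfl, twistForm_simple]
    simp only [smul_eq_mul]
    rw [zpow_add₀ hv, zpow_sub₀ hv, ← Nat.cast_add, zpow_natCast, zpow_natCast, zpow_natCast]
    ring
  · intro q hq
    rw [map_smul, hcoord, if_neg hq, smul_zero]

/-- The coefficient of `⟨m⁻_{ℓ,i}⟩` in `e'_i ⟨m⟩`. -/
noncomputable def adjointCoeff (m : Multisegment n) (ℓ : ℕ+) (i : ZMod n) : Cv :=
  v ^ expo m ℓ i * v ^ (-(m (ℓ, i) : ℤ) + 1) * growth m ℓ i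

theorem geom_sum_v (a : ℕ) :
    (1 - v ^ 2) * ∑ k ∈ Finset.range (a + 1), (v ^ (-2 : ℤ)) ^ k =
      v ^ (-2 * (a : ℤ)) * (1 - v ^ (2 * (a + 1))) := by
  have hv := v_ne_zero
  have h1 := geom_sum_mul (v ^ (-2 : ℤ)) (a + 1)
  -- both sides are geometric sums, in `v⁻²` and up to the factor `v^{-2a}` in `v²`
  have h2 : (1 - v ^ 2 : Cv) = v ^ 2 * (v ^ (-2 : ℤ) - 1) := by
    rw [mul_sub, mul_one, ← zpow_natCast, ← zpow_add₀ hv]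
    norm_num
  have h3 : (v ^ (-2 : ℤ)) ^ (a + 1) = v ^ (-2 * (a : ℤ) - 2) := by
    rw [← zpow_natCast, ← zpow_mul]
    congr 1
    push_cast
    ring
  rw [h2, mul_assoc, mul_comm (_ - 1), h1, h3, mul_sub, mul_sub, mul_one, mul_one,
    ← zpow_natCast v 2, ← zpow_natCast v (2 * (a + 1)), ← zpow_add₀ hv, ← zpow_add₀ hv]
  congr 2
  · push_cast
    ring
  · push_cast
    ring

/-- The two coefficients that determine the adjoint of `f_i` agree. -/
theorem normSq_mul_coord [NeZero n] (hn : 2 ≤ n) {ℓ : ℕ+} (h : m (ℓ, i) ≠ 0) :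
    normSq m * (pbw n).coord m (chevalleyF i (pbw n (minus m ℓ i))) =
      normSq (minus m ℓ i) * adjointCoeff m ℓ i := by
  have hv := v_ne_zero
  have hphi := phiProd_minus hn h
  have ho := orbitDim_minus hn h
  have hc := headCount_eq (m := m) (i := i) ℓ
  obtain ⟨a, ha⟩ := Nat.exists_eq_succ_of_ne_zero h
  have hg := geom_sum_v a
  have h1 := phiProd_ne_zero m
  have h2 := phiProd_ne_zero (minus m ℓ i)
  rw [coord_chevalleyF hn, hallPolynomial_minus hn h, simpleHallPoly, ho, normSq, normSq,
    adjointCoeff, expo_eq, totalDim_minus h, hc, ha]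
  rw [ha, Nat.succ_eq_add_one] at hphi
  simp only [map_mul, map_pow, aeval_X, map_sum, Nat.succ_eq_add_one]
  generalize (∑ k ∈ Finset.range (a + 1), (v ^ (-2 : ℤ)) ^ k) = s at hg ⊢
  generalize m.headCount i (ℓ + 1) = A
  generalize m.headCount (i - 1) ℓ = B
  -- the exponents from the orbit dimensions, the twist and the Hall polynomial add up to `expo`
  have h3 : v ^ (((A + (a + 1) : ℕ) : ℤ) + B - 1) * (v ^ (-2 : ℤ)) ^ A * v ^ (-2 * (a : ℤ)) =
      v ^ ((B : ℤ) - A) * v ^ (-((a + 1 : ℕ) : ℤ) + 1) := by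
    rw [← zpow_natCast, ← zpow_mul, ← zpow_add₀ hv, ← zpow_add₀ hv, ← zpow_add₀ hv]
    congr 1
    push_cast
    ring
  rw [div_mul_eq_mul_div, div_mul_eq_mul_div, div_eq_div_iff h1 h2, pow_succ]
  linear_combination ((1 - v ^ 2) ^ (minus m ℓ i).totalDim * phiProd (minus m ℓ i) *
      v ^ (((A + (a + 1) : ℕ) : ℤ) + B - 1) * (v ^ (-2 : ℤ)) ^ A) * hg +
    ((1 - v ^ 2) ^ (minus m ℓ i).totalDim * phiProd (minus m ℓ i) *
      (1 - v ^ (2 * (a + 1)))) * h3 -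
    ((1 - v ^ 2) ^ (minus m ℓ i).totalDim * v ^ ((B : ℤ) - A) *
      v ^ (-((a + 1 : ℕ) : ℤ) + 1)) * hphi

/-- The value of the adjoint at `⟨m⟩`. -/
noncomputable def adjointValue (m : Multisegment n) (i : ZMod n) : HallSpace n :=
  (v ^ expo m 1 i * v ^ (-(m (1, i) : ℤ) + 1)) • pbwMinus m 1 i +
    ∑ᶠ (ℓ : ℕ+) (_ : 2 ≤ ℓ),
      (v ^ expo m ℓ i * v ^ (-(m (ℓ, i) : ℤ) + 1) * (1 - v ^ (2 * (m (ℓ - 1, i - 1) + 1)))) •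
        pbwMinus m ℓ i

theorem adjointValue_eq (m : Multisegment n) (i : ZMod n) :
    adjointValue m i = ∑ ℓ ∈ insert 1 (finite_support_fst (m := m) i).toFinset,
      adjointCoeff m ℓ i • pbwMinus m ℓ i := by
  have h2 : ∀ ℓ : ℕ+, 2 ≤ ℓ ↔ ℓ ≠ 1 := fun ℓ => by
    rw [← PNat.coe_le_coe, ← PNat.coe_inj.ne, PNat.val_ofNat, PNat.val_ofNat]
    have := ℓ.pos
    omega
  rw [← Finset.add_sum_erase _ _ (Finset.mem_insert_self _ _), adjointValue, adjointCoeff, growth,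
    if_pos rfl, mul_one]
  congr 1
  rw [← finsum_mem_eq_sum_of_inter_support_eq (s := {ℓ : ℕ+ | 2 ≤ ℓ})]
  · refine finsum_congr fun ℓ => finsum_congr fun hℓ => ?_
    rw [adjointCoeff, growth, if_neg ((h2 ℓ).mp hℓ)]
  · ext ℓ
    simp only [Set.mem_inter_iff, Set.mem_ofPred_eq, h2, Finset.coe_erase, Finset.coe_insert,
      Set.Finite.coe_toFinset, Set.mem_sdiff, Set.mem_insert_iff, Set.mem_singleton_iff]
    refine and_congr_left fun h => ?_
    constructor
    · intro h1
      refine ⟨Or.inr fun h3 => h ?_, h1⟩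
      simp only [pbwMinus, if_pos h3, smul_zero]
    · exact fun h1 => h1.2

theorem coord_pbwMinus (m p : Multisegment n) (ℓ : ℕ+) (i : ZMod n) :
    (pbw n).coord p (pbwMinus m ℓ i) = if m (ℓ, i) ≠ 0 ∧ minus m ℓ i = p then 1 else 0 := by
  rw [pbwMinus]
  by_cases h : m (ℓ, i) = 0
  · simp [h]
  · rw [if_neg h, Module.Basis.coord_apply, Module.Basis.repr_self, Finsupp.single_apply]
    simp [h]

theorem normSq_mul_coord_adjointValue [NeZero n] (hn : 2 ≤ n) (m p : Multisegment n) :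
    normSq p * (pbw n).coord p (adjointValue m i) =
      normSq m * (pbw n).coord m (chevalleyF i (pbw n p)) := by
  rw [adjointValue_eq, map_sum]
  simp only [map_smul, coord_pbwMinus, smul_eq_mul, mul_ite, mul_one, mul_zero]
  by_cases h : ∃ ℓ, m (ℓ, i) ≠ 0 ∧ minus m ℓ i = p
  · obtain ⟨ℓ, hℓ, rfl⟩ := h
    rw [normSq_mul_coord hn hℓ, Finset.sum_eq_single ℓ, if_pos ⟨hℓ, rfl⟩]
    · rintro k - hk
      exact if_neg fun h => hk (minus_injective hn h.1 hℓ h.2)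
    · exact fun h => absurd (Finset.mem_insert_of_mem
        ((finite_support_fst i).mem_toFinset.mpr hℓ)) h
  · rw [Finset.sum_eq_zero fun ℓ _ => if_neg fun h' => h ⟨ℓ, h'⟩, coord_chevalleyF hn,
      hallPolynomial_eq_zero hn fun ℓ hℓ hp => h ⟨ℓ, hℓ, hp.symm⟩, map_zero, mul_zero, mul_zero,
      mul_zero]

theorem isAdjointPair_iff [NeZero n] (hn : 2 ≤ n) (e : Module.End Cv (HallSpace n)) :
    LinearMap.IsAdjointPair (scalarProduct n) (scalarProduct n) e (chevalleyF i) ↔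
      ∀ m, e (pbw n m) = adjointValue m i := by
  constructor
  · intro h m
    refine (pbw n).ext_elem fun p => mul_left_cancel₀ (normSq_ne_zero p) ?_
    have h1 := h (pbw n m) (pbw n p)
    rw [scalarProduct_pbw_right, scalarProduct_pbw] at h1
    exact h1.trans (normSq_mul_coord_adjointValue hn m p).symm
  · intro h
    rw [LinearMap.isAdjointPair_iff_comp_eq_compl₂]
    refine (pbw n).ext fun m => (pbw n).ext fun p => ?_
    rw [LinearMap.comp_apply, LinearMap.compl₂_apply, h, scalarProduct_pbw_right,
      scalarProduct_pbw, normSq_mul_coord_adjointValue hn]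

end CyclicHall

theorem proposition4p2 (n : ℕ) [NeZero n] (hn : 2 ≤ n) (i : ZMod n) :
    (∃! e : Module.End CyclicHall.Cv (CyclicHall.HallSpace n),
      LinearMap.IsAdjointPair (CyclicHall.scalarProduct n) (CyclicHall.scalarProduct n)
        e (CyclicHall.chevalleyF i)) ∧
    ∀ e : Module.End CyclicHall.Cv (CyclicHall.HallSpace n),
      LinearMap.IsAdjointPair (CyclicHall.scalarProduct n) (CyclicHall.scalarProduct n)
        e (CyclicHall.chevalleyF i) →
      ∀ m : Multisegment n,
        e (CyclicHall.pbw n m) =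
          (CyclicHall.v ^ CyclicHall.expo m 1 i * CyclicHall.v ^ (-(m (1, i) : ℤ) + 1)) •
              CyclicHall.pbwMinus m 1 i +
            ∑ᶠ (ℓ : ℕ+) (_ : 2 ≤ ℓ),
              (CyclicHall.v ^ CyclicHall.expo m ℓ i *
                CyclicHall.v ^ (-(m (ℓ, i) : ℤ) + 1) *
                (1 - CyclicHall.v ^ (2 * (m (ℓ - 1, i - 1) + 1)))) •
                CyclicHall.pbwMinus m ℓ i := by
  refine ⟨⟨(CyclicHall.pbw n).constr CyclicHall.Cv fun m => CyclicHall.adjointValue m i,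
    (CyclicHall.isAdjointPair_iff hn _).mpr fun m => Module.Basis.constr_basis _ _ _ _,
    fun e he => (CyclicHall.pbw n).ext fun m => ?_⟩,
    fun e he => (CyclicHall.isAdjointPair_iff hn e).mp he⟩
  rw [(CyclicHall.isAdjointPair_iff hn e).mp he, Module.Basis.constr_basis]
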